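/- Let $(X,\{R_0,\dots,R_D\})$ be a symmetric association scheme with $D\ge 3$ classes which is metric with respect to the ordering $A_0,\dots,A_D$ of its associate matrices, cometric with respect to the ordering $E_0,\dots,E_D$ of its primitive idempotents ($E_0=|X|^{-1}J$), and such that the graph $(X,R_1)$ is not an ordinary cycle. Let $V=\mathbb{C}^X$ with standard basis $\{\hat x:x\in X\}$. For $x\in X$ let $E_i^*(x)$ be the diagonal matrix with $(y,y)$-entry $(A_i)_{xy}$, and let the Terwilliger algebra $T(x)$ be the algebra generated by all $A_i$ and all $E_i^*(x)$ $(0\le i\le D)$. For an irreducible $T(x)$-module $W\subseteq V$ put $r(W)=\min\{i:E_i^*(x)W\ne0\}$ and $r^*(W)=\min\{j:E_jW\neq 0\}$. A vector $\chi\in V$ is a relative $t$-design with respect to $x$ if $E_j\chi$ and $E_j\hat x$ are linearly dependent for all $1\le j\le t$. Let $Y\subseteq X$ with $1<|Y|<|X|$, let $\chi_Y=\sum_{y\in Y}\hat y$ be its characteristic vector, and let $\delta=\min\{i\neq 0:\langle\chi_Y,A_i\chi_Y\rangle\ne0\}$ be its minimum distance. Let $0\le t\le D$, and suppose that $E_k^*(x)\chi_Y$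 is a relative $t$-design with respect to $x$ for every $0\le k\le D$ and every $x\in Y$. If for every $x\in Y$ each irreducible $T(x)$-module $W\subseteq V$ with $1\le r(W)\le\delta$ satisfies $r^*(W)\le r(W)$, then one of the following holds: (i) $(X,R_1)$ is bipartite and $Y$ is a bipartite half (one of its two colour classes); (ii) the scheme is an antipodal double cover (that is, $R_0\cup R_D$ is an equivalence relation all of whose classes have size two), and $Y$ is an antipodal pair (one of these classes); (iii) $\delta\ge t+1$. -/

import Mathlib

open scoped Matrix

/-- A symmetric association scheme with `D` classes on a finite set `X`. The partition
`R_0, …, R_D` of `X × X` is encoded by the map `cls` sending `(x, y)` to the index `i` of the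
unique relation `R_i` that contains it; `p i j h` is the intersection number `p^h_{ij}`. -/
structure SymmAssocScheme (X : Type*) [Fintype X] (D : ℕ) where
  cls : X → X → Fin (D + 1)
  cls_surj : ∀ i, ∃ x y, cls x y = i
  cls_eq_zero_iff : ∀ x y, cls x y = 0 ↔ x = y
  cls_symm : ∀ x y, cls x y = cls y x
  p : Fin (D + 1) → Fin (D + 1) → Fin (D + 1) → ℕ
  card_eq_p : ∀ i j h x y, cls x y = h →
    (Finset.univ.filter fun z => cls x z = i ∧ cls z y = j).card = p i j h

namespace SymmAssocScheme

/-- One of `i, j, h` is greater than the sum of the other two. -/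
def ExceedsSum (i j h : ℕ) : Prop := i + j < h ∨ j + h < i ∨ h + i < j

/-- One of `i, j, h` is equal to the sum of the other two. -/
def EqualsSum (i j h : ℕ) : Prop := i + j = h ∨ j + h = i ∨ h + i = j

variable {X : Type*} [Fintype X] [DecidableEq X] {D : ℕ}

/-- The associate matrix `A_i`. -/
def assocMatrix (S : SymmAssocScheme X D) (i : Fin (D + 1)) : Matrix X X ℂ :=
  Matrix.of fun x y => if S.cls x y = i then 1 else 0

/-- The Bose-Mesner algebra `M`, the span of the associate matrices. -/
def boseMesner (S : SymmAssocScheme X D) : Submodule ℂ (Matrix X X ℂ) :=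
  Submodule.span ℂ (Set.range S.assocMatrix)

/-- The dual idempotent `E_i^*(x)`: the diagonal matrix with `(y, y)`-entry `(A_i)_{xy}`. -/
def dualIdem (S : SymmAssocScheme X D) (x : X) (i : Fin (D + 1)) : Matrix X X ℂ :=
  Matrix.diagonal fun y => S.assocMatrix i x y

/-- The dual Bose-Mesner algebra `M^*(x)`, the span of the dual idempotents. -/
def dualBoseMesner (S : SymmAssocScheme X D) (x : X) : Submodule ℂ (Matrix X X ℂ) :=
  Submodule.span ℂ (Set.range (S.dualIdem x))

/-- The Terwilliger algebra `T(x)`, generated by `M` and `M^*(x)`. -/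
def terwilliger (S : SymmAssocScheme X D) (x : X) : Subalgebra ℂ (Matrix X X ℂ) :=
  Algebra.adjoin ℂ ((S.boseMesner : Set (Matrix X X ℂ)) ∪ S.dualBoseMesner x)

/-- `W ⊆ V = ℂ^X` is an irreducible `T(x)`-module. -/
def IsIrreducibleModule (S : SymmAssocScheme X D) (x : X) (W : Submodule ℂ (X → ℂ)) : Prop :=
  W ≠ ⊥ ∧ (∀ F ∈ S.terwilliger x, ∀ w ∈ W, F *ᵥ w ∈ W) ∧
    ∀ U : Submodule ℂ (X → ℂ), U ≤ W → (∀ F ∈ S.terwilliger x, ∀ u ∈ U, F *ᵥ u ∈ U) →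
      U = ⊥ ∨ U = W

/-- `E_0, …, E_D` is an ordering of the primitive idempotents of the Bose-Mesner algebra, with
`E_0 = |X|⁻¹ J`. (As `M` has dimension `D + 1`, any `D + 1` nonzero pairwise orthogonal
idempotents in `M` are precisely the primitive idempotents of `M`.) -/
structure IsPrimitiveIdempotents (S : SymmAssocScheme X D)
    (E : Fin (D + 1) → Matrix X X ℂ) : Prop where
  mem : ∀ i, E i ∈ S.boseMesner
  ne_zero : ∀ i, E i ≠ 0
  idem : ∀ i, E i * E i = E i
  orth : ∀ i j, i ≠ j → E i * E j = 0
  sum_eq_one : ∑ i, E i = 1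
  zero_eq : E 0 = (Fintype.card X : ℂ)⁻¹ • Matrix.of fun _ _ => 1

/-- The scheme is metric with respect to the ordering `A_0, …, A_D`: `p^h_{ij} = 0`
(resp. `p^h_{ij} ≠ 0`) whenever one of `i, j, h` is greater than (resp. equal to) the sum of the
other two. -/
def IsMetric (S : SymmAssocScheme X D) : Prop :=
  ∀ i j h : Fin (D + 1), (ExceedsSum i j h → S.p i j h = 0) ∧ (EqualsSum i j h → S.p i j h ≠ 0)

/-- The scheme is cometric with respect to the ordering `E_0, …, E_D` of its primitive
idempotents: the Krein parameters `q^h_{ij}`, defined by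
`E_i ∘ E_j = |X|⁻¹ ∑_h q^h_{ij} E_h` (entrywise product), satisfy `q^h_{ij} = 0`
(resp. `q^h_{ij} ≠ 0`) whenever one of `i, j, h` is greater than (resp. equal to) the sum of the
other two. -/
def IsCometric (S : SymmAssocScheme X D) (E : Fin (D + 1) → Matrix X X ℂ) : Prop :=
  S.IsPrimitiveIdempotents E ∧ ∃ q : Fin (D + 1) → Fin (D + 1) → Fin (D + 1) → ℂ,
    (∀ i j, E i ⊙ E j = (Fintype.card X : ℂ)⁻¹ • ∑ h, q i j h • E h) ∧
    ∀ i j h : Fin (D + 1), (ExceedsSum i j h → q i j h = 0) ∧ (EqualsSum i j h → q i j h ≠ 0)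

/-- The least index `i` with `F_i W ≠ 0`. -/
noncomputable def leastIndex (F : Fin (D + 1) → Matrix X X ℂ) (W : Submodule ℂ (X → ℂ)) : ℕ :=
  sInf {n : ℕ | ∃ i : Fin (D + 1), (i : ℕ) = n ∧ ∃ w ∈ W, F i *ᵥ w ≠ 0}

/-- The endpoint `r(W) = min {i : E_i^*(x) W ≠ 0}`. -/
noncomputable def endpoint (S : SymmAssocScheme X D) (x : X) (W : Submodule ℂ (X → ℂ)) : ℕ :=
  leastIndex (S.dualIdem x) W

/-- The dual endpoint `r^*(W) = min {j : E_j W ≠ 0}`. -/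
noncomputable def dualEndpoint (E : Fin (D + 1) → Matrix X X ℂ) (W : Submodule ℂ (X → ℂ)) : ℕ :=
  leastIndex E W

/-- The characteristic vector of `Y`. -/
def charVec (Y : Finset X) : X → ℂ := fun y => if y ∈ Y then 1 else 0

/-- `Y` is a code: `1 < |Y| < |X|`. -/
def IsCode (Y : Finset X) : Prop := 1 < Y.card ∧ Y.card < Fintype.card X

/-- The minimum distance `δ(Y) = min {i ≠ 0 : ⟨χ_Y, A_i χ_Y⟩ ≠ 0}`. -/
noncomputable def minDistance (S : SymmAssocScheme X D) (Y : Finset X) : ℕ :=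
  sInf {n : ℕ | ∃ i : Fin (D + 1), (i : ℕ) = n ∧ i ≠ 0 ∧
    star (charVec Y) ⬝ᵥ (S.assocMatrix i *ᵥ charVec Y) ≠ 0}

/-- `χ` is a relative `t`-design with respect to `x`: `E_j χ` and `E_j x̂` are linearly dependent
for all `1 ≤ j ≤ t`. -/
def IsRelativeDesign (E : Fin (D + 1) → Matrix X X ℂ) (t : ℕ) (x : X) (χ : X → ℂ) : Prop :=
  ∀ j : Fin (D + 1), 1 ≤ (j : ℕ) → (j : ℕ) ≤ t →
    ¬ LinearIndependent ℂ ![E j *ᵥ χ, E j *ᵥ Pi.single x 1]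

/-- The graph `(X, R_1)` (`x ≠ y` is automatic when `D ≥ 1`). -/
def graph (S : SymmAssocScheme X D) : SimpleGraph X where
  Adj x y := x ≠ y ∧ (S.cls x y : ℕ) = 1
  symm := ⟨fun x y h => ⟨h.1.symm, by rw [S.cls_symm y x]; exact h.2⟩⟩
  loopless := ⟨fun _ h => h.1 rfl⟩

/-- `(X, R_1)` is an ordinary cycle, i.e. a connected graph of valency two. -/
def IsOrdinaryCycle (S : SymmAssocScheme X D) : Prop :=
  S.graph.Connected ∧ ∀ x, (S.graph.neighborSet x).ncard = 2

/-- The metric scheme is an antipodal double cover: `R_0 ∪ R_D` is an equivalence relation, and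
all its classes have size two. -/
def IsAntipodalDoubleCover (S : SymmAssocScheme X D) : Prop :=
  Equivalence (fun x y => S.cls x y = 0 ∨ S.cls x y = Fin.last D) ∧
    ∀ x, {y | S.cls x y = 0 ∨ S.cls x y = Fin.last D}.ncard = 2

/-- `Y` is an antipodal pair. -/
def IsAntipodalPair (S : SymmAssocScheme X D) (Y : Finset X) : Prop :=
  ∃ x y, S.cls x y = Fin.last D ∧ Y = {x, y}

/-- `Y` is a bipartite half: it is one of the two colour classes of a bipartition of the
graph `(X, R_1)`. -/
def IsBipartiteHalf (S : SymmAssocScheme X D) (Y : Finset X) : Prop :=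
  S.graph.IsBipartiteWith (Y : Set X) (Y : Set X)ᶜ

end SymmAssocScheme

/-! Suppose `δ ≤ t` and let `x ∈ Y`. Restrict `χ_Y` to the sphere of radius `δ` about `x` and
subtract its mean there. The resulting vector is orthogonal to the primary module `M x̂`; together
with the design condition this gives that `E_0, …, E_δ` all kill it.

Such a vector is zero (`eq_zero_of_dualEndpoint_le`). Otherwise it has a nonzero projection `w` to
some irreducible `W` orthogonal to the primary module, with `1 ≤ r(W) ≤ δ`. Consider the pieces `W ⊓
splitSpace i`. Modulo scalars, `A_1` moves piece `i` into piece `i + 1`, and the diagonal matrix of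
row `x` of `E_1` moves it into piece `i - 1`. The sum of the pieces is therefore a submodule; it
contains `w`, so it is `W`. But `r^*(W) ≤ r(W)` makes `E_{r^*}` kill every piece: pieces of index at
least `r^*` by definition, and smaller ones are zero because they live inside radius less than `r`.

Hence `χ_Y` is constant on the sphere: if `x ∈ Y` has a codeword at distance `δ`, the whole sphere
lies in `Y`. The rest is combinatorics on `δ`. For `δ = 1` connectivity gives `Y = X`; `δ = 2` gives
a bipartite half (`isBipartiteHalf_of_closed`); `3 ≤ δ < D` forces valency two
(`isOrdinaryCycle_of_separated`); `δ = D` makes the scheme antipodal, and `antipode_unique` shows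
that its classes have size two. -/

namespace SymmAssocScheme

/-! ### Distance combinatorics of metric schemes -/

section Metric

variable {X : Type*} [Fintype X] {D : ℕ} (S : SymmAssocScheme X D)

/-- The index of the relation containing `(x, y)`, as a natural number. For a metric scheme this
is the distance in the graph `(X, R_1)`. -/
def dist (x y : X) : ℕ := S.cls x y

lemma dist_le (x y : X) : S.dist x y ≤ D := Nat.lt_succ_iff.mp (S.cls x y).2

lemma dist_comm (x y : X) : S.dist x y = S.dist y x := by
  rw [dist, dist, S.cls_symm]

lemma dist_eq_zero {x y : X} : S.dist x y = 0 ↔ x = y := by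
  rw [← S.cls_eq_zero_iff, dist, Fin.ext_iff, Fin.val_zero]

lemma dist_self (x : X) : S.dist x x = 0 := S.dist_eq_zero.2 rfl

lemma cls_eq_iff {x y : X} {i : Fin (D + 1)} : S.cls x y = i ↔ S.dist x y = i := by
  rw [dist, Fin.ext_iff]

lemma card_filter_eq_card_filter {x y x' y' : X} (h : S.dist x y = S.dist x' y')
    (i j : Fin (D + 1)) :
    (Finset.univ.filter fun z => S.cls x z = i ∧ S.cls z y = j).card =
      (Finset.univ.filter fun z => S.cls x' z = i ∧ S.cls z y' = j).card := by
  rw [S.card_eq_p i j (S.cls x y) x y rfl, S.card_eq_p i j (S.cls x y) x' y' (Fin.ext h.symm)]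

/-- A triangle over one pair of a relation can be moved to any other pair of that relation. -/
lemma exists_transport {x y x' y' z : X} (h : S.dist x y = S.dist x' y') :
    ∃ z', S.dist x' z' = S.dist x z ∧ S.dist z' y' = S.dist z y := by
  have hz : (Finset.univ.filter fun v => S.cls x v = S.cls x z ∧ S.cls v y = S.cls z y).Nonempty :=
    ⟨z, by simp⟩
  rw [← Finset.card_pos, S.card_filter_eq_card_filter h, Finset.card_pos] at hz
  obtain ⟨z', hz'⟩ := hz
  simp only [Finset.mem_filter, Finset.mem_univ, true_and] at hz'
  exact ⟨z', congrArg Fin.val hz'.1, congrArg Fin.val hz'.2⟩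

/-- Uniqueness of the apex of a triangle can be moved from one pair to any other pair of the same
relation. -/
lemma unique_transport {x y x' y' : X} (h : S.dist x y = S.dist x' y') {i j : ℕ}
    (hu : ∀ z w, S.dist x z = i → S.dist z y = j → S.dist x w = i → S.dist w y = j → z = w)
    {z w : X} (hz : S.dist x' z = i) (hz' : S.dist z y' = j)
    (hw : S.dist x' w = i) (hw' : S.dist w y' = j) : z = w := by
  have hc : (Finset.univ.filter fun v => S.cls x v = S.cls x' z ∧ S.cls v y = S.cls z y').card
      ≤ 1 := by
    rw [Finset.card_le_one]
    intro a ha b hb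
    simp only [Finset.mem_filter, Finset.mem_univ, true_and, cls_eq_iff] at ha hb
    exact hu a b (ha.1.trans hz) (ha.2.trans hz') (hb.1.trans hz) (hb.2.trans hz')
  rw [S.card_filter_eq_card_filter h, Finset.card_le_one] at hc
  refine hc z (by simp) w ?_
  simp only [Finset.mem_filter, Finset.mem_univ, true_and, cls_eq_iff]
  exact ⟨hw.trans hz.symm, hw'.trans hz'.symm⟩

variable {S}

namespace IsMetric

variable (hP : S.IsMetric)
include hP

lemma exists_dist {x y : X} {i j : ℕ} (hi : i ≤ D) (hj : j ≤ D)
    (h : EqualsSum i j (S.dist x y)) : ∃ z, S.dist x z = i ∧ S.dist z y = j := by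
  have h1 := (hP ⟨i, by omega⟩ ⟨j, by omega⟩ (S.cls x y)).2 h
  rw [← S.card_eq_p _ _ _ x y rfl, ← Nat.pos_iff_ne_zero, Finset.card_pos] at h1
  obtain ⟨z, hz⟩ := h1
  simp only [Finset.mem_filter, Finset.mem_univ, true_and, cls_eq_iff] at hz
  exact ⟨z, hz⟩

lemma dist_triangle (x y z : X) : S.dist x z ≤ S.dist x y + S.dist y z := by
  by_contra! hlt
  have h1 := (hP (S.cls x y) (S.cls y z) (S.cls x z)).1 (Or.inl hlt)
  rw [← S.card_eq_p _ _ _ x z rfl, Finset.card_eq_zero] at h1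
  exact Finset.notMem_empty y (h1 ▸ by simp)

/-- A set of vertices that is closed under adjacency contains all vertices. -/
lemma forall_of_adj (hD : 1 ≤ D) {p : X → Prop} {x : X} (hx : p x)
    (hp : ∀ y z, p y → S.dist y z = 1 → p z) (y : X) : p y := by
  generalize hn : S.dist x y = n
  induction n generalizing y with
  | zero => exact S.dist_eq_zero.1 hn ▸ hx
  | succ n ih =>
    have := S.dist_le x y
    obtain ⟨z, hz, hzy⟩ := hP.exists_dist (x := x) (y := y) (i := n) (j := 1) (by omega) hD
      (Or.inl hn.symm)
    exact hp z y (ih z hz) hzy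

lemma exists_dist_eq (x : X) {i : ℕ} (hi : i ≤ D) : ∃ y, S.dist x y = i := by
  obtain ⟨y, hy, -⟩ := hP.exists_dist (x := x) (y := x) hi hi
    (by rw [S.dist_self]; exact Or.inr (Or.inr (by omega)))
  exact ⟨y, hy⟩

lemma graph_connected [Nonempty X] (hD : 1 ≤ D) : S.graph.Connected := by
  rw [SimpleGraph.connected_iff]
  refine ⟨fun x y => ?_, inferInstance⟩
  refine hP.forall_of_adj hD (p := fun y => S.graph.Reachable x y) (x := x)
    (SimpleGraph.Reachable.refl _) (fun y z hy hyz => hy.trans (SimpleGraph.Adj.reachable ?_)) y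
  refine ⟨fun h => ?_, hyz⟩
  subst h
  simp [S.dist_self] at hyz

/-- If the sphere of radius `δ` around `x` is `δ`-separated, with `3 ≤ δ < D`, then the graph
is an ordinary cycle. -/
lemma isOrdinaryCycle_of_separated {δ : ℕ} (h3 : 3 ≤ δ) (hδ : δ < D) (x : X)
    (hx : ∀ y z, S.dist x y = δ → S.dist x z = δ → y ≠ z → δ ≤ S.dist y z) :
    S.IsOrdinaryCycle := by
  have : Nonempty X := ⟨x⟩
  refine ⟨hP.graph_connected (by omega), ?_⟩
  -- Two such neighbours of `v` would be at distance at most `2 < δ`. Thus `c_{δ+1} ≤ 1` and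
  -- `b_{δ-1} ≤ 1`.
  have huniq : ∀ v z w, S.dist x z = δ → S.dist z v = 1 → S.dist x w = δ → S.dist w v = 1 →
      z = w := by
    intro v z w hz hzv hw hwv
    by_contra hne
    have h1 := hx z w hz hw hne
    have h2 := hP.dist_triangle z v w
    rw [S.dist_comm v w] at h2
    omega
  obtain ⟨v₁, hv₁⟩ := hP.exists_dist_eq x (i := δ + 1) (by omega)
  obtain ⟨v₀, hv₀⟩ := hP.exists_dist_eq x (i := δ - 1) (by omega)
  obtain ⟨y, hy⟩ := hP.exists_dist_eq x (i := δ) (by omega)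
  obtain ⟨c, hxc, hcy⟩ := hP.exists_dist (x := x) (y := y) (i := δ - 1) (j := 1) (by omega)
    (by omega) (Or.inl (by omega))
  obtain ⟨b, hxb, hby⟩ := hP.exists_dist (x := x) (y := y) (i := δ + 1) (j := 1) (by omega)
    (by omega) (Or.inr (Or.inl (by omega)))
  obtain ⟨x₁, hxx₁, hx₁y⟩ := hP.exists_dist (x := x) (y := y) (i := 1) (j := δ + 1) (by omega)
    (by omega) (Or.inr (Or.inr (by omega)))
  obtain ⟨x₀, hxx₀, hx₀y⟩ := hP.exists_dist (x := x) (y := y) (i := 1) (j := δ - 1) (by omega)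
    (by omega) (Or.inl (by omega))
  -- Separation gives `a_δ = 0`. Replacing `x` by its neighbour `x₁` farther from `y` gives `c_δ ≤
  -- c_{δ+1}`, and by its neighbour `x₀` nearer to `y` gives `b_δ ≤ b_{δ-1}`.
  have hnbr : ∀ z, S.dist z y = 1 → z = c ∨ z = b := by
    intro z hz
    have t1 := hP.dist_triangle x z y
    have t2 := hP.dist_triangle x y z
    have t3 := S.dist_comm y z
    have hne : S.dist x z ≠ δ := by
      intro h
      have h4 := hx z y h hy (fun h => by simp [h, S.dist_self] at hz)
      omega
    obtain h | h : S.dist x z = δ - 1 ∨ S.dist x z = δ + 1 := by omega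
    · left
      have key : ∀ u, S.dist x u = δ - 1 → S.dist u y = 1 → S.dist x₁ u = δ := by
        intro u hu huy
        have s1 := hP.dist_triangle x₁ u y
        have s2 := hP.dist_triangle x₁ x u
        have s3 := S.dist_comm x x₁
        omega
      exact S.unique_transport (hv₁.trans hx₁y.symm) (huniq v₁) (key z h hz) hz (key c hxc hcy) hcy
    · right
      have key : ∀ u, S.dist x u = δ + 1 → S.dist u y = 1 → S.dist x₀ u = δ := by
        intro u hu huy
        have s1 := hP.dist_triangle x₀ y u
        have s2 := hP.dist_triangle x x₀ u
        have s3 := S.dist_comm y u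
        omega
      exact S.unique_transport (hv₀.trans hx₀y.symm) (huniq v₀) (key z h hz) hz (key b hxb hby) hby
  have hne : c ≠ b := fun h => by subst h; omega
  intro v
  let one : Fin (D + 1) := ⟨1, by omega⟩
  have hset : ∀ v, S.graph.neighborSet v =
      ((Finset.univ.filter fun z => S.cls v z = one ∧ S.cls z v = one : Finset X) : Set X) := by
    intro v
    ext z
    simp only [SimpleGraph.mem_neighborSet, Finset.coe_filter, Finset.mem_univ, true_and,
      Set.mem_ofPred_eq, cls_eq_iff, S.dist_comm z v, and_self]
    refine ⟨fun h => h.2, fun h => ⟨fun he => ?_, h⟩⟩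
    simp [he, S.dist_self, one] at h
  have hy2 : S.graph.neighborSet y = {c, b} := by
    ext z
    rw [hset]
    simp only [Finset.coe_filter, Finset.mem_univ, true_and,
      Set.mem_ofPred_eq, cls_eq_iff, S.dist_comm y z, and_self, Set.mem_insert_iff,
      Set.mem_singleton_iff]
    constructor
    · exact hnbr z
    · rintro (rfl | rfl)
      exacts [hcy, hby]
  rw [hset v, Set.ncard_coe_finset, S.card_filter_eq_card_filter (x' := y) (y' := y)
    (by rw [S.dist_self, S.dist_self]), ← Set.ncard_coe_finset, ← hset, hy2, Set.ncard_pair hne]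

/-- If `a_2 = 0` then `a_1 = 0`. -/
lemma triangle_free (hD : 3 ≤ D)
    (ha : ∀ x y z, S.dist x y = 2 → S.dist x z = 2 → S.dist y z ≠ 1) {x y z : X}
    (hxy : S.dist x y = 1) (hxz : S.dist x z = 1) : S.dist y z ≠ 1 := by
  intro hyz
  obtain ⟨w, hxw, hwy⟩ := hP.exists_dist (x := x) (y := y) (i := 2) (j := 1) (by omega)
    (by omega) (Or.inr (Or.inl (by omega)))
  -- At distance two, `x` and `z` would be adjacent on the sphere of radius two about `w`.
  have hwz : S.dist w z = 1 := by
    have t1 := hP.dist_triangle w y z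
    have t2 := hP.dist_triangle x z w
    have t3 := S.dist_comm w z
    have t4 := ha w x z (by rw [S.dist_comm, hxw])
    omega
  obtain ⟨v, hxv, hvw⟩ := hP.exists_dist (x := x) (y := w) (i := 3) (j := 1) (by omega)
    (by omega) (Or.inr (Or.inl (by omega)))
  have key : ∀ u, S.dist x u = 1 → S.dist w u = 1 → S.dist v u = 2 := by
    intro u hu hwu
    have t1 := hP.dist_triangle v w u
    have t2 := hP.dist_triangle x u v
    have t3 := S.dist_comm u v
    omega
  exact ha v y z (key y hxy hwy) (key z hxz hwz) hyz

/-- The sphere of radius two about `x` lies in the edgeless set `Y`, so `a_2 = 0`, and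
`triangle_free` gives `a_1 = 0`. Two neighbours of a vertex are then equal or at distance two, so
membership in `Y` alternates along edges. -/
lemma isBipartiteHalf_of_closed (hD : 3 ≤ D) {Y : Finset X} {x : X} (hx : x ∈ Y)
    (hsep : ∀ y ∈ Y, ∀ z ∈ Y, y ≠ z → 2 ≤ S.dist y z)
    (hG : ∀ y ∈ Y, (∃ z ∈ Y, S.dist y z = 2) → ∀ z, S.dist y z = 2 → z ∈ Y)
    (hx2 : ∃ z ∈ Y, S.dist x z = 2) : S.IsBipartiteHalf Y := by
  have hno : ∀ y ∈ Y, ∀ z, S.dist y z = 1 → z ∉ Y := by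
    intro y hy z hyz hz
    have := hsep y hy z hz (fun h => by simp [h, S.dist_self] at hyz)
    omega
  have ha : ∀ u y z, S.dist u y = 2 → S.dist u z = 2 → S.dist y z ≠ 1 := by
    intro u y z huy huz hyz
    obtain ⟨v, hv⟩ := hP.exists_dist_eq x (i := 2) (by omega)
    obtain ⟨w, hw, hwv⟩ := S.exists_transport (z := z) (huy.trans hv.symm)
    refine hno w (hG x hx hx2 w (hw.trans huz)) v ?_ (hG x hx hx2 v hv)
    rw [hwv, S.dist_comm, hyz]
  have htri := fun {x y z} => hP.triangle_free hD ha (x := x) (y := y) (z := z)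
  -- Membership alone does not propagate; the invariant also records that the sphere of radius two
  -- stays in `Y`.
  have hall : ∀ v, (v ∈ Y ∧ ∀ z, S.dist v z = 2 → z ∈ Y) ∨
      (v ∉ Y ∧ ∀ u, S.dist v u = 1 → u ∈ Y ∧ ∀ z, S.dist u z = 2 → z ∈ Y) := by
    refine hP.forall_of_adj (by omega) (x := x) (Or.inl ⟨hx, hG x hx hx2⟩) ?_
    rintro y z (⟨hy, hy2⟩ | ⟨hy, hy1⟩) hyz
    · right
      refine ⟨hno y hy z hyz, fun u hzu => ?_⟩
      by_cases huy : u = y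
      · subst huy; exact ⟨hy, hy2⟩
      have t1 := hP.dist_triangle y z u
      have t2 : S.dist y u ≠ 0 := fun h => huy (S.dist_eq_zero.1 h).symm
      have t3 := htri (by rw [S.dist_comm, hyz]) hzu
      have t4 : S.dist y u = 2 := by omega
      have hu := hy2 u t4
      exact ⟨hu, hG u hu ⟨y, hy, by rw [S.dist_comm, t4]⟩⟩
    · exact Or.inl (hy1 z hyz)
  refine ⟨disjoint_compl_right, fun v w hvw => ?_⟩
  have h1 : S.dist v w = 1 := hvw.2
  rcases hall v with ⟨hv, -⟩ | ⟨hv, hv'⟩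
  · exact Or.inl ⟨hv, by simpa using hno v hv w h1⟩
  · exact Or.inr ⟨by simpa using hv, (hv' w h1).1⟩

end IsMetric

end Metric

/-! ### The Bose-Mesner and Terwilliger algebras -/

section Algebra

open scoped ComplexOrder

variable {X : Type*} [Fintype X] [DecidableEq X] {D : ℕ} {S : SymmAssocScheme X D}

omit [DecidableEq X] in
lemma mem_boseMesner_iff {F : Matrix X X ℂ} :
    F ∈ S.boseMesner ↔ ∃ a : Fin (D + 1) → ℂ, ∀ x y, F x y = a (S.cls x y) := by
  rw [boseMesner, Submodule.mem_span_range_iff_exists_fun]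
  refine exists_congr fun a => ?_
  rw [← Matrix.ext_iff]
  simp [Matrix.sum_apply, assocMatrix, eq_comm]

omit [DecidableEq X] in
lemma assocMatrix_mem (i : Fin (D + 1)) : S.assocMatrix i ∈ S.boseMesner :=
  Submodule.subset_span ⟨i, rfl⟩

lemma assocMatrix_zero : S.assocMatrix 0 = 1 := by
  ext x y
  simp [assocMatrix, S.cls_eq_zero_iff, Matrix.one_apply]

lemma one_mem_boseMesner : (1 : Matrix X X ℂ) ∈ S.boseMesner :=
  assocMatrix_zero (S := S) ▸ assocMatrix_mem 0

omit [DecidableEq X] in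
lemma assocMatrix_mul_assocMatrix (i j : Fin (D + 1)) :
    S.assocMatrix i * S.assocMatrix j = ∑ h, (S.p i j h : ℂ) • S.assocMatrix h := by
  ext x y
  simp only [Matrix.mul_apply, assocMatrix, Matrix.of_apply, Matrix.sum_apply, Matrix.smul_apply,
    smul_eq_mul, mul_ite, mul_one, mul_zero, Finset.sum_ite_eq, Finset.mem_univ, if_true]
  rw [← S.card_eq_p i j _ x y rfl, Finset.card_filter]
  push_cast
  refine Finset.sum_congr rfl fun z _ => ?_
  by_cases h1 : S.cls x z = i <;> by_cases h2 : S.cls z y = j <;> simp [h1, h2]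

lemma mul_mem_boseMesner {F G : Matrix X X ℂ} (hF : F ∈ S.boseMesner) (hG : G ∈ S.boseMesner) :
    F * G ∈ S.boseMesner := by
  have h := Submodule.mul_mem_mul hF hG
  rw [boseMesner, Submodule.span_mul_span] at h
  refine (Submodule.span_le.2 ?_) h
  rintro _ ⟨_, ⟨i, rfl⟩, _, ⟨j, rfl⟩, rfl⟩
  simp only [SetLike.mem_coe, assocMatrix_mul_assocMatrix]
  exact Submodule.sum_mem _ fun h _ => Submodule.smul_mem _ _ (assocMatrix_mem h)

omit [DecidableEq X] in
lemma apply_comm_of_mem {F : Matrix X X ℂ} (hF : F ∈ S.boseMesner) (x y : X) : F x y = F y x := by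
  obtain ⟨a, ha⟩ := mem_boseMesner_iff.1 hF
  rw [ha, ha, S.cls_symm]

omit [DecidableEq X] in
lemma apply_congr_of_mem {F : Matrix X X ℂ} (hF : F ∈ S.boseMesner) {x y x' y' : X}
    (h : S.dist x y = S.dist x' y') : F x y = F x' y' := by
  obtain ⟨a, ha⟩ := mem_boseMesner_iff.1 hF
  rw [ha, ha, Fin.ext h]

omit [DecidableEq X] in
lemma conjTranspose_mem {F : Matrix X X ℂ} (hF : F ∈ S.boseMesner) : Fᴴ ∈ S.boseMesner := by
  obtain ⟨a, ha⟩ := mem_boseMesner_iff.1 hF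
  refine mem_boseMesner_iff.2 ⟨fun i => star (a i), fun x y => ?_⟩
  rw [Matrix.conjTranspose_apply, ha, S.cls_symm]

omit [DecidableEq X] in
/-- A subspace preserved by the first two terms of a sequence of matrices that satisfies a
three-term-like recurrence is preserved by all of them. -/
lemma mulVec_mem_of_recurrence {B : Fin (D + 1) → Matrix X X ℂ}
    {c : Fin (D + 1) → Fin (D + 1) → ℂ} {e : Fin (D + 1)}
    (hrec : ∀ i, B e * B i = ∑ h, c i h • B h)
    (hc0 : ∀ i h : Fin (D + 1), (i : ℕ) + 1 < h → c i h = 0)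
    (hc1 : ∀ i h : Fin (D + 1), (i : ℕ) + 1 = h → c i h ≠ 0)
    {U : Submodule ℂ (X → ℂ)} (h0 : ∀ u ∈ U, B 0 *ᵥ u ∈ U) (he : ∀ u ∈ U, B e *ᵥ u ∈ U)
    (i : Fin (D + 1)) : ∀ u ∈ U, B i *ᵥ u ∈ U := by
  obtain ⟨n, hn⟩ := i
  induction n using Nat.strong_induction_on with
  | _ n ih =>
    intro u hu
    rcases n with _ | n
    · exact h0 u hu
    set i : Fin (D + 1) := ⟨n, by omega⟩
    set j : Fin (D + 1) := ⟨n + 1, hn⟩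
    have h1 : B e *ᵥ (B i *ᵥ u) ∈ U := he _ (ih n (by omega) _ u hu)
    rw [Matrix.mulVec_mulVec, hrec, Matrix.sum_mulVec, ← Finset.add_sum_erase _ _
      (Finset.mem_univ j)] at h1
    have h2 : ∑ h ∈ Finset.univ.erase j, (c i h • B h) *ᵥ u ∈ U := by
      refine Submodule.sum_mem _ fun h hh => ?_
      rw [Matrix.smul_mulVec]
      rcases lt_or_ge n h with hlt | hle
      · have : (h : ℕ) ≠ n + 1 := fun h' => Finset.ne_of_mem_erase hh (Fin.ext h')
        rw [hc0 i h (show n + 1 < h by omega), zero_smul]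
        exact U.zero_mem
      · exact U.smul_mem _ (ih h (by omega) h.2 u hu)
    rw [Submodule.add_mem_iff_left _ h2, Matrix.smul_mulVec] at h1
    exact (U.smul_mem_iff (hc1 i j rfl)).1 h1

lemma IsMetric.assocMatrix_mulVec_mem (hP : S.IsMetric) {e : Fin (D + 1)} (he : (e : ℕ) = 1)
    {U : Submodule ℂ (X → ℂ)} (hU : ∀ u ∈ U, S.assocMatrix e *ᵥ u ∈ U) (i : Fin (D + 1)) :
    ∀ u ∈ U, S.assocMatrix i *ᵥ u ∈ U := by
  refine mulVec_mem_of_recurrence (c := fun i h => S.p e i h) (assocMatrix_mul_assocMatrix e)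
    (fun i h hih => ?_) (fun i h hih => ?_) (fun u hu => ?_) hU i
  · exact_mod_cast (hP e i h).1 (Or.inl (by omega))
  · exact_mod_cast (hP e i h).2 (Or.inl (by omega))
  · rwa [assocMatrix_zero, Matrix.one_mulVec]

/-- A subspace preserved by the `A_i` and the `E_i^*(x)` is a `T(x)`-module. -/
lemma terwilliger_mulVec_mem {x : X} {U : Submodule ℂ (X → ℂ)}
    (hA : ∀ i, ∀ u ∈ U, S.assocMatrix i *ᵥ u ∈ U) (hE : ∀ i, ∀ u ∈ U, S.dualIdem x i *ᵥ u ∈ U)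
    {F : Matrix X X ℂ} (hF : F ∈ S.terwilliger x) : ∀ u ∈ U, F *ᵥ u ∈ U := by
  have hspan : ∀ (B : Fin (D + 1) → Matrix X X ℂ), (∀ i, ∀ u ∈ U, B i *ᵥ u ∈ U) →
      ∀ G ∈ Submodule.span ℂ (Set.range B), ∀ u ∈ U, G *ᵥ u ∈ U := by
    intro B hB G hG u hu
    obtain ⟨c, rfl⟩ := (Submodule.mem_span_range_iff_exists_fun ℂ).1 hG
    rw [Matrix.sum_mulVec]
    refine Submodule.sum_mem _ fun i _ => ?_
    rw [Matrix.smul_mulVec]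
    exact U.smul_mem _ (hB i u hu)
  rw [terwilliger] at hF
  induction hF using Algebra.adjoin_induction with
  | mem G hG =>
    rcases hG with hG | hG
    · exact hspan _ hA G hG
    · exact hspan _ hE G hG
  | algebraMap r =>
    intro u hu
    rw [Algebra.algebraMap_eq_smul_one, Matrix.smul_mulVec, Matrix.one_mulVec]
    exact U.smul_mem _ hu
  | add F G _ _ hF hG =>
    intro u hu
    rw [Matrix.add_mulVec]
    exact U.add_mem (hF u hu) (hG u hu)
  | mul F G _ _ hF hG =>
    intro u hu
    rw [← Matrix.mulVec_mulVec]
    exact hF _ (hG u hu)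

lemma mem_terwilliger_of_mem {x : X} {F : Matrix X X ℂ} (hF : F ∈ S.boseMesner) :
    F ∈ S.terwilliger x := Algebra.subset_adjoin (Or.inl hF)

lemma dualIdem_mem {x : X} (i : Fin (D + 1)) : S.dualIdem x i ∈ S.terwilliger x :=
  Algebra.subset_adjoin (Or.inr (Submodule.subset_span ⟨i, rfl⟩))

lemma dualIdem_mulVec_apply (x y : X) (i : Fin (D + 1)) (v : X → ℂ) :
    (S.dualIdem x i *ᵥ v) y = if S.cls x y = i then v y else 0 := by
  simp [dualIdem, Matrix.mulVec_diagonal, assocMatrix]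

lemma diagonal_mem_terwilliger {x : X} {F : Matrix X X ℂ} (hF : F ∈ S.boseMesner) :
    Matrix.diagonal (fun y => F x y) ∈ S.terwilliger x := by
  obtain ⟨a, ha⟩ := mem_boseMesner_iff.1 hF
  have : Matrix.diagonal (fun y => F x y) = ∑ i, a i • S.dualIdem x i := by
    ext y z
    simp only [Matrix.sum_apply, Matrix.smul_apply, dualIdem, Matrix.diagonal_apply, ha]
    by_cases h : y = z <;> simp [h, assocMatrix]
  rw [this]
  exact Subalgebra.sum_mem _ fun i _ => Subalgebra.smul_mem _ (dualIdem_mem i) _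

lemma conjTranspose_mem_terwilliger {x : X} {F : Matrix X X ℂ} (hF : F ∈ S.terwilliger x) :
    Fᴴ ∈ S.terwilliger x := by
  rw [terwilliger] at hF
  induction hF using Algebra.adjoin_induction with
  | mem G hG =>
    rcases hG with hG | hG
    · exact mem_terwilliger_of_mem (conjTranspose_mem hG)
    · obtain ⟨c, rfl⟩ := (Submodule.mem_span_range_iff_exists_fun ℂ).1 hG
      rw [Matrix.conjTranspose_sum]
      refine Subalgebra.sum_mem _ fun i _ => ?_
      rw [Matrix.conjTranspose_smul]
      refine Subalgebra.smul_mem _ ?_ _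
      convert dualIdem_mem (S := S) (x := x) i using 1
      rw [dualIdem, Matrix.diagonal_conjTranspose]
      congr 1
      ext y
      simp [assocMatrix, apply_ite]
  | algebraMap r =>
    rw [Algebra.algebraMap_eq_smul_one, Matrix.conjTranspose_smul, Matrix.conjTranspose_one]
    exact Subalgebra.smul_mem _ (Subalgebra.one_mem _) _
  | add F G _ _ hF hG =>
    rw [Matrix.conjTranspose_add]
    exact Subalgebra.add_mem _ hF hG
  | mul F G _ _ hF hG =>
    rw [Matrix.conjTranspose_mul]
    exact Subalgebra.mul_mem _ hG hF

/-! ### Primitive idempotents and Krein parameters -/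

namespace IsPrimitiveIdempotents

variable {E : Fin (D + 1) → Matrix X X ℂ} (hE : S.IsPrimitiveIdempotents E)
include hE

lemma sum_smul_mul (c : Fin (D + 1) → ℂ) (j : Fin (D + 1)) :
    (∑ i, c i • E i) * E j = c j • E j := by
  rw [Finset.sum_mul, Finset.sum_eq_single j]
  · rw [Matrix.smul_mul, hE.idem]
  · intro i _ hij
    rw [Matrix.smul_mul, hE.orth i j hij, smul_zero]
  · simp

lemma linearIndependent : LinearIndependent ℂ E := by
  rw [Fintype.linearIndependent_iff]
  intro c hc j
  have h := hE.sum_smul_mul c j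
  rw [hc, zero_mul] at h
  exact (smul_eq_zero.1 h.symm).resolve_right (hE.ne_zero j)

lemma span_eq : Submodule.span ℂ (Set.range E) = S.boseMesner := by
  refine Submodule.eq_of_le_of_finrank_le (Submodule.span_le.2 ?_) ?_
  · rintro _ ⟨i, rfl⟩
    exact hE.mem i
  · rw [finrank_span_eq_card hE.linearIndependent]
    exact finrank_range_le_card S.assocMatrix

lemma exists_eigenvalues {F : Matrix X X ℂ} (hF : F ∈ S.boseMesner) :
    ∃ θ : Fin (D + 1) → ℂ, F = ∑ i, θ i • E i ∧ ∀ j, F * E j = θ j • E j ∧ E j * F = θ j • E j := by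
  rw [← hE.span_eq] at hF
  obtain ⟨θ, rfl⟩ := (Submodule.mem_span_range_iff_exists_fun ℂ).1 hF
  refine ⟨θ, rfl, fun j => ⟨hE.sum_smul_mul θ j, ?_⟩⟩
  rw [Finset.mul_sum, Finset.sum_eq_single j]
  · rw [Matrix.mul_smul, hE.idem]
  · intro i _ hij
    rw [Matrix.mul_smul, hE.orth j i hij.symm, smul_zero]
  · simp

/-- `(E j)ᴴ` lies in the Bose-Mesner algebra, so `(E j)ᴴ * E j` is a nonzero multiple of `E j`.
Taking adjoints makes `E j` a multiple of `(E j)ᴴ`, and as both are nonzero idempotents the factor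
is 1. -/
lemma conjTranspose_eq (j : Fin (D + 1)) : (E j)ᴴ = E j := by
  obtain ⟨θ, -, hθ⟩ := hE.exists_eigenvalues (conjTranspose_mem (hE.mem j))
  have h1 := (hθ j).1
  have h0 : θ j ≠ 0 := by
    intro h
    rw [h, zero_smul, Matrix.conjTranspose_mul_self_eq_zero] at h1
    exact hE.ne_zero j h1
  have h2 := congrArg Matrix.conjTranspose h1
  rw [Matrix.conjTranspose_mul, Matrix.conjTranspose_conjTranspose, h1,
    Matrix.conjTranspose_smul] at h2
  have h3 : E j = ((θ j)⁻¹ * star (θ j)) • (E j)ᴴ := by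
    rw [mul_smul, ← h2, smul_smul, inv_mul_cancel₀ h0, one_smul]
  set l := (θ j)⁻¹ * star (θ j)
  have hH : (E j)ᴴ ≠ 0 := fun h => hE.ne_zero j (by rw [h3, h, smul_zero])
  have h4 : (l * l) • (E j)ᴴ = l • (E j)ᴴ := by
    have h5 : (E j)ᴴ * (E j)ᴴ = (E j)ᴴ := by rw [← Matrix.conjTranspose_mul, hE.idem]
    have h6 := hE.idem j
    rw [h3, Matrix.smul_mul, Matrix.mul_smul, h5, smul_smul] at h6
    exact h6
  have h5 := smul_left_injective ℂ hH h4
  have hl : l ≠ 0 := mul_ne_zero (inv_ne_zero h0) (star_ne_zero.2 h0)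
  have h6 : l = 1 := mul_left_cancel₀ hl (h5.trans (mul_one l).symm)
  rw [h6, one_smul] at h3
  exact h3.symm

lemma apply_self_ne_zero (j : Fin (D + 1)) (x : X) : E j x x ≠ 0 := by
  intro h
  have h1 : (E j).trace = 0 := by
    refine Finset.sum_eq_zero fun y _ => ?_
    rw [Matrix.diag_apply, ← h]
    exact apply_congr_of_mem (hE.mem j) (by rw [S.dist_self, S.dist_self])
  rw [← hE.idem j] at h1
  nth_rw 1 [← hE.conjTranspose_eq j] at h1
  exact hE.ne_zero j (Matrix.trace_conjTranspose_mul_self_eq_zero_iff.1 h1)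

/-- A vanishing Krein parameter `q^h_{ij}` gives a vanishing triple product
`E_h A_i^*(x) E_j`. -/
lemma mul_diagonal_mul_eq_zero {i j h : Fin (D + 1)} {q : Fin (D + 1) → ℂ}
    (hq : E i ⊙ E j = (Fintype.card X : ℂ)⁻¹ • ∑ h, q h • E h) (hqh : q h = 0) (x : X) :
    E h * Matrix.diagonal (fun y => E i x y) * E j = 0 := by
  set N : X → Matrix X X ℂ := fun x => E h * Matrix.diagonal (fun y => E i x y) * E j with hN
  -- The squared norms of the `N x` are nonnegative and sum to `tr (E_h (E_i ∘ E_j))`, a multiple of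
  -- `q h`.
  have hsum : ∑ x, (N x * (N x)ᴴ).trace = 0 := by
    have h1 : ∀ x, (N x * (N x)ᴴ).trace =
        ∑ y, ∑ z, E h y z * E j z y * (E i y x * E i x z) := by
      intro x
      have h2 : (N x * (N x)ᴴ).trace = ((E h * Matrix.diagonal (fun y => E i x y)) *
          (E j * Matrix.diagonal (fun y => E i y x))).trace := by
        have h3 : (Matrix.diagonal fun y => E i x y)ᴴ = Matrix.diagonal fun y => E i y x := by
          rw [Matrix.diagonal_conjTranspose]
          congr 1
          ext y
          rw [Pi.star_apply, ← Matrix.conjTranspose_apply, hE.conjTranspose_eq]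
        rw [hN, Matrix.conjTranspose_mul, Matrix.conjTranspose_mul, hE.conjTranspose_eq,
          hE.conjTranspose_eq, h3]
        simp only [Matrix.mul_assoc]
        rw [Matrix.trace_mul_comm (E h)]
        simp only [Matrix.mul_assoc, hE.idem]
        rw [← Matrix.mul_assoc (E j) (E j), hE.idem, Matrix.trace_mul_comm (E h)]
        simp only [Matrix.mul_assoc]
      rw [h2]
      simp only [Matrix.trace, Matrix.diag_apply, Matrix.mul_apply (M := E h * _),
        Matrix.mul_diagonal]
      exact Finset.sum_congr rfl fun y _ => Finset.sum_congr rfl fun z _ => by ring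
    simp only [h1]
    rw [Finset.sum_comm]
    have h4 : ∀ y, ∑ x, ∑ z, E h y z * E j z y * (E i y x * E i x z) =
        ∑ z, E h y z * (E i ⊙ E j) z y := by
      intro y
      rw [Finset.sum_comm]
      refine Finset.sum_congr rfl fun z _ => ?_
      rw [← Finset.mul_sum, ← Matrix.mul_apply, hE.idem, Matrix.hadamard_apply,
        apply_comm_of_mem (hE.mem i) z y]
      ring
    have h5 : (E h * (E i ⊙ E j)).trace = 0 := by
      rw [hq, Matrix.mul_smul, Finset.mul_sum, Finset.sum_eq_zero, smul_zero, Matrix.trace_zero]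
      intro l _
      rw [Matrix.mul_smul]
      by_cases hl : h = l
      · rw [← hl, hqh, zero_smul]
      · rw [hE.orth h l hl, smul_zero]
    simpa only [Matrix.trace, Matrix.diag_apply, Matrix.mul_apply, h4] using h5
  rw [Finset.sum_eq_zero_iff_of_nonneg
    fun x _ => (Matrix.posSemidef_self_mul_conjTranspose (N x)).trace_nonneg] at hsum
  exact Matrix.trace_mul_conjTranspose_self_eq_zero_iff.1 (hsum x (Finset.mem_univ x))

end IsPrimitiveIdempotents

namespace IsCometric

variable {E : Fin (D + 1) → Matrix X X ℂ} (hQ : S.IsCometric E)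
include hQ

lemma mul_diagonal_mul_eq_zero {i j h : Fin (D + 1)} (hijh : ExceedsSum i j h) (x : X) :
    E h * Matrix.diagonal (fun y => E i x y) * E j = 0 := by
  obtain ⟨hE, q, hq, hq'⟩ := hQ
  exact hE.mul_diagonal_mul_eq_zero (hq i j) ((hq' i j h).1 hijh) x

/-- Dual of `IsMetric.assocMatrix_mulVec_mem`: on row `x`, entrywise products become products of
diagonal matrices, with Krein parameters as recurrence coefficients. -/
lemma diagonal_mulVec_mem {e : Fin (D + 1)} (he : (e : ℕ) = 1) {x : X}
    {U : Submodule ℂ (X → ℂ)}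
    (hU : ∀ u ∈ U, Matrix.diagonal (fun y => E e x y) *ᵥ u ∈ U) {F : Matrix X X ℂ}
    (hF : F ∈ S.boseMesner) :
    ∀ u ∈ U, Matrix.diagonal (fun y => F x y) *ᵥ u ∈ U := by
  obtain ⟨hE, q, hq, hq'⟩ := hQ
  have hX : (Fintype.card X : ℂ)⁻¹ ≠ 0 := by
    have : Nonempty X := ⟨x⟩
    simp
  have key := mulVec_mem_of_recurrence (B := fun i => Matrix.diagonal (fun y => E i x y))
    (c := fun i h => (Fintype.card X : ℂ)⁻¹ * q e i h) (e := e) (fun i => ?_)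
    (fun i h hih => ?_) (fun i h hih => ?_) (U := U) (fun u hu => ?_) hU
  · intro u hu
    obtain ⟨θ, hθ, -⟩ := hE.exists_eigenvalues hF
    have : Matrix.diagonal (fun y => F x y) = ∑ i, θ i • Matrix.diagonal (fun y => E i x y) := by
      ext y z
      simp only [Matrix.sum_apply, Matrix.smul_apply, Matrix.diagonal_apply, hθ]
      by_cases h : y = z <;> simp [h]
    rw [this, Matrix.sum_mulVec]
    refine Submodule.sum_mem _ fun i _ => ?_
    rw [Matrix.smul_mulVec]
    exact U.smul_mem _ (key i u hu)
  · have h1 : ∀ y, E e x y * E i x y = (Fintype.card X : ℂ)⁻¹ * ∑ h, q e i h * E h x y := by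
      intro y
      have h2 := congrFun (congrFun (hq e i) x) y
      simpa [Matrix.sum_apply] using h2
    ext y z
    simp only [Matrix.diagonal_mul_diagonal, Matrix.sum_apply, Matrix.smul_apply,
      Matrix.diagonal_apply, h1]
    by_cases h : y = z <;> simp [h, Finset.mul_sum, mul_assoc]
  · simp [(hq' e i h).1 (Or.inl (by omega))]
  · exact mul_ne_zero hX ((hq' e i h).2 (Or.inl (by omega)))
  · have : (fun y => E 0 x y) = fun _ => (Fintype.card X : ℂ)⁻¹ := by
      ext y
      simp [hE.zero_eq]
    simp only [this]
    rw [← Matrix.smul_one_eq_diagonal, Matrix.smul_mulVec, Matrix.one_mulVec]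
    exact U.smul_mem _ hu

/-- The entries of `E_1` separate the relations. -/
lemma dist_eq_of_apply_eq {e : Fin (D + 1)} (he : (e : ℕ) = 1) {x y z : X}
    (h : E e x y = E e x z) : S.dist x y = S.dist x z := by
  -- If `E_1` does not separate `y` from `z`, this space is invariant under all the dual
  -- idempotents; one of them, applied to the all-ones vector, separates `y` from `z` unless the
  -- relations agree.
  let U : Submodule ℂ (X → ℂ) :=
    { carrier := {u | u y = u z}
      add_mem' := fun {a b} ha hb => by
        simp only [Set.mem_ofPred_eq, Pi.add_apply] at *; rw [ha, hb]
      zero_mem' := rfl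
      smul_mem' := fun c u hu => by
        simp only [Set.mem_ofPred_eq, Pi.smul_apply] at *; rw [hu] }
  have hU : ∀ u, u ∈ U ↔ u y = u z := fun u => Iff.rfl
  have key := hQ.diagonal_mulVec_mem he (x := x) (U := U) (fun u hu => by
    rw [hU] at *
    rw [Matrix.mulVec_diagonal, Matrix.mulVec_diagonal, h, hu])
    (assocMatrix_mem (S.cls x y)) 1 ((hU _).2 rfl)
  rw [hU, Matrix.mulVec_diagonal, Matrix.mulVec_diagonal] at key
  simp only [assocMatrix, Matrix.of_apply, if_true, Pi.one_apply, mul_one] at key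
  by_contra hne
  rw [if_neg (fun h' => hne (congrArg Fin.val h').symm)] at key
  exact one_ne_zero key

end IsCometric

end Algebra

/-! ### Irreducible modules and the split decomposition -/

section TerwilligerModules

open scoped ComplexOrder

variable {X : Type*} [Fintype X] [DecidableEq X] {D : ℕ} {S : SymmAssocScheme X D}

omit [DecidableEq X] in
/-- Orthogonal decomposition of a vector of `ℂ^X` along a subspace. -/
lemma exists_add_orthogonal (W : Submodule ℂ (X → ℂ)) (u : X → ℂ) :
    ∃ w ∈ W, ∃ v, (∀ z ∈ W, star z ⬝ᵥ v = 0) ∧ u = w + v := by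
  let L := WithLp.linearEquiv 2 ℂ (X → ℂ)
  obtain ⟨w, hw, v, hv, h⟩ := (W.comap L.toLinearMap).exists_add_mem_mem_orthogonal (L.symm u)
  refine ⟨L w, hw, L v, fun z hz => ?_, ?_⟩
  · have := (Submodule.mem_orthogonal _ _).1 hv (L.symm z) (by simpa using hz)
    rw [EuclideanSpace.inner_eq_star_dotProduct, dotProduct_comm] at this
    exact this
  · rw [← map_add, ← h, LinearEquiv.apply_symm_apply]

/-- A nonzero vector has a nonzero component in some irreducible module that it generates: there
are an irreducible module `W`, contained in every module containing `u`, and a decomposition of `u`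
along `W` that is respected by `T(x)`. -/
lemma exists_irreducible {x : X} {u : X → ℂ} (hu : u ≠ 0) :
    ∃ W : Submodule ℂ (X → ℂ), S.IsIrreducibleModule x W ∧
      (∀ U : Submodule ℂ (X → ℂ), (∀ F ∈ S.terwilliger x, ∀ v ∈ U, F *ᵥ v ∈ U) → u ∈ U → W ≤ U) ∧
      ∃ w ∈ W, w ≠ 0 ∧ (∀ F ∈ S.terwilliger x, F *ᵥ u = 0 → F *ᵥ w = 0) := by
  let N : Submodule ℂ (X → ℂ) :=
    (Subalgebra.toSubmodule (S.terwilliger x)).map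
      ((LinearMap.applyₗ u).comp (Matrix.toLin' (R := ℂ) (m := X) (n := X)).toLinearMap)
  have hN : ∀ v, v ∈ N ↔ ∃ F ∈ S.terwilliger x, F *ᵥ u = v := fun v => Iff.rfl
  let P : Set (Submodule ℂ (X → ℂ)) :=
    {W | W ≠ ⊥ ∧ W ≤ N ∧ ∀ F ∈ S.terwilliger x, ∀ w ∈ W, F *ᵥ w ∈ W}
  have huN : u ∈ N := (hN u).2 ⟨1, Subalgebra.one_mem _, Matrix.one_mulVec u⟩
  have hP : P.Nonempty := by
    refine ⟨N, fun h => hu ?_, le_rfl, fun F hF w hw => ?_⟩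
    · rwa [h, Submodule.mem_bot] at huN
    · obtain ⟨G, hG, rfl⟩ := (hN w).1 hw
      exact (hN _).2 ⟨F * G, Subalgebra.mul_mem _ hF hG, (Matrix.mulVec_mulVec _ _ _).symm⟩
  obtain ⟨W, ⟨hW0, hWN, hWT⟩, hmin⟩ := WellFounded.has_min
    (wellFounded_lt (α := Submodule ℂ (X → ℂ))) P hP
  have hperp : ∀ F ∈ S.terwilliger x, ∀ v : X → ℂ, (∀ z ∈ W, star z ⬝ᵥ v = 0) →
      ∀ z ∈ W, star z ⬝ᵥ (F *ᵥ v) = 0 := by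
    intro F hF v hv z hz
    rw [Matrix.dotProduct_mulVec, ← Matrix.conjTranspose_conjTranspose F, ← Matrix.star_mulVec]
    exact hv _ (hWT _ (conjTranspose_mem_terwilliger hF) z hz)
  obtain ⟨w, hw, v, hv, huw⟩ := exists_add_orthogonal W u
  refine ⟨W, ⟨hW0, hWT, fun U hU hUT => ?_⟩, fun U hUT huU => hWN.trans fun z hz => ?_,
    w, hw, fun hw0 => ?_, fun F hF hFu => ?_⟩
  · by_contra! hne
    exact hmin U ⟨hne.1, hU.trans hWN, hUT⟩ (lt_of_le_of_ne hU hne.2)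
  · obtain ⟨F, hF, rfl⟩ := (hN z).1 hz
    exact hUT F hF u huU
  -- If the projection were zero, all of `T u` would be orthogonal to `W`, which is contained in `T
  -- u`.
  · rw [hw0, zero_add] at huw
    apply hW0
    rw [Submodule.eq_bot_iff]
    intro z hz
    obtain ⟨F, hF, rfl⟩ := (hN z).1 (hWN hz)
    exact dotProduct_star_self_eq_zero.1 (hperp F hF u (huw ▸ hv) _ hz)
  -- `F w = -F v` lies both in `W` and in its orthogonal complement.
  · rw [huw, Matrix.mulVec_add] at hFu
    have h1 := hperp F hF v hv _ (hWT F hF w hw)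
    rw [eq_neg_of_add_eq_zero_right hFu, dotProduct_neg, neg_eq_zero] at h1
    exact dotProduct_star_self_eq_zero.1 h1

omit [DecidableEq X] in
lemma leastIndex_le {F : Fin (D + 1) → Matrix X X ℂ} {W : Submodule ℂ (X → ℂ)}
    {i : Fin (D + 1)} {w : X → ℂ} (hw : w ∈ W) (hF : F i *ᵥ w ≠ 0) : leastIndex F W ≤ i :=
  Nat.sInf_le ⟨i, rfl, w, hw, hF⟩

omit [DecidableEq X] in
lemma exists_leastIndex_eq {F : Fin (D + 1) → Matrix X X ℂ} {W : Submodule ℂ (X → ℂ)}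
    {i : Fin (D + 1)} {w : X → ℂ} (hw : w ∈ W) (hF : F i *ᵥ w ≠ 0) :
    ∃ j : Fin (D + 1), (j : ℕ) = leastIndex F W ∧ ∃ w ∈ W, F j *ᵥ w ≠ 0 :=
  Nat.sInf_mem (s := {n : ℕ | ∃ i : Fin (D + 1), (i : ℕ) = n ∧ ∃ w ∈ W, F i *ᵥ w ≠ 0})
    ⟨_, i, rfl, w, hw, hF⟩

/-- The vectors supported on the ball of radius `i` around `x` that are orthogonal to the first
`i + 1` eigenspaces. -/
def splitSpace (S : SymmAssocScheme X D) (E : Fin (D + 1) → Matrix X X ℂ) (x : X) (i : ℕ) :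
    Submodule ℂ (X → ℂ) where
  carrier := {v | (∀ y, i < S.dist x y → v y = 0) ∧ ∀ j : Fin (D + 1), (j : ℕ) ≤ i → E j *ᵥ v = 0}
  zero_mem' := ⟨fun _ _ => rfl, fun _ _ => Matrix.mulVec_zero _⟩
  add_mem' := by
    rintro a b ⟨ha, ha'⟩ ⟨hb, hb'⟩
    refine ⟨fun y hy => ?_, fun j hj => ?_⟩
    · rw [Pi.add_apply, ha y hy, hb y hy, add_zero]
    · rw [Matrix.mulVec_add, ha' j hj, hb' j hj, add_zero]
  smul_mem' := by
    rintro c a ⟨ha, ha'⟩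
    refine ⟨fun y hy => ?_, fun j hj => ?_⟩
    · rw [Pi.smul_apply, ha y hy, smul_zero]
    · rw [Matrix.mulVec_smul, ha' j hj, smul_zero]

variable {E : Fin (D + 1) → Matrix X X ℂ}

omit [DecidableEq X] in
lemma mem_splitSpace {x : X} {i : ℕ} {v : X → ℂ} : v ∈ S.splitSpace E x i ↔
    (∀ y, i < S.dist x y → v y = 0) ∧ ∀ j : Fin (D + 1), (j : ℕ) ≤ i → E j *ᵥ v = 0 := Iff.rfl

omit [DecidableEq X] in
lemma assocMatrix_mulVec_apply (i : Fin (D + 1)) (v : X → ℂ) (x : X) :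
    (S.assocMatrix i *ᵥ v) x = ∑ y with S.cls x y = i, v y := by
  simp [Matrix.mulVec, dotProduct, assocMatrix, Finset.sum_filter]

/-- Raising: `A_1` widens the support by one, and subtracting its eigenvalue on `E_{i+1}` removes
that component too, so `A_1 - θ_{i+1}` maps piece `i` into piece `i + 1`. -/
lemma assocMatrix_one_mulVec_mem (hP : S.IsMetric) (hE : S.IsPrimitiveIdempotents E)
    {e : Fin (D + 1)} (he : (e : ℕ) = 1) {x : X} {W : Submodule ℂ (X → ℂ)}
    (hW : ∀ w ∈ W, S.assocMatrix e *ᵥ w ∈ W) :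
    ∀ v ∈ ⨆ i, W ⊓ S.splitSpace E x i, S.assocMatrix e *ᵥ v ∈ ⨆ i, W ⊓ S.splitSpace E x i := by
  intro v hv
  induction hv using Submodule.iSup_induction' with
  | zero => rw [Matrix.mulVec_zero]; exact Submodule.zero_mem _
  | add a b _ _ ha hb => rw [Matrix.mulVec_add]; exact Submodule.add_mem _ ha hb
  | mem i v hv =>
    obtain ⟨hvW, hv⟩ := hv
    obtain ⟨θ, -, hθ⟩ := hE.exists_eigenvalues (assocMatrix_mem (S := S) e)
    -- For `i ≥ D` there is no such eigenvalue, and any value serves.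
    obtain ⟨l, hl⟩ : ∃ l : ℂ, ∀ j : Fin (D + 1), (j : ℕ) = i + 1 → θ j = l := by
      by_cases h : i + 1 < D + 1
      · exact ⟨θ ⟨i + 1, h⟩, fun j hj => congrArg θ (Fin.ext hj)⟩
      · exact ⟨0, fun j hj => absurd j.2 (hj ▸ h)⟩
    have h1 : S.assocMatrix e *ᵥ v = (S.assocMatrix e *ᵥ v - l • v) + l • v := by abel
    rw [h1]
    refine Submodule.add_mem _ ?_ (Submodule.smul_mem _ _ (Submodule.mem_iSup_of_mem i ⟨hvW, hv⟩))
    refine Submodule.mem_iSup_of_mem (i + 1)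
      ⟨W.sub_mem (hW v hvW) (W.smul_mem l hvW), mem_splitSpace.2 ⟨fun y hy => ?_, fun j hj => ?_⟩⟩
    · rw [Pi.sub_apply, Pi.smul_apply, hv.1 y (by omega), smul_zero, sub_zero]
      rw [assocMatrix_mulVec_apply]
      refine Finset.sum_eq_zero fun z hz => hv.1 z ?_
      rw [Finset.mem_filter, cls_eq_iff] at hz
      have h2 := hP.dist_triangle x z y
      rw [S.dist_comm z y, hz.2, he] at h2
      omega
    · rw [Matrix.mulVec_sub, Matrix.mulVec_smul, Matrix.mulVec_mulVec, (hθ j).2,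
        Matrix.smul_mulVec]
      rcases Nat.lt_or_ge i j with h | h
      · rw [hl j (by omega), sub_self]
      · rw [hv.2 j h, smul_zero, smul_zero, sub_zero]

/-- Lowering: subtracting the value of row `x` of `E_1` at distance `i` removes the outermost
sphere, while vanishing triple products cost only one eigenspace. -/
lemma diagonal_one_mulVec_mem (hQ : S.IsCometric E)
    {e : Fin (D + 1)} (he : (e : ℕ) = 1) {x : X} {W : Submodule ℂ (X → ℂ)}
    (hW : ∀ w ∈ W, Matrix.diagonal (fun y => E e x y) *ᵥ w ∈ W) :
    ∀ v ∈ ⨆ i, W ⊓ S.splitSpace E x i,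
      Matrix.diagonal (fun y => E e x y) *ᵥ v ∈ ⨆ i, W ⊓ S.splitSpace E x i := by
  intro v hv
  induction hv using Submodule.iSup_induction' with
  | zero => rw [Matrix.mulVec_zero]; exact Submodule.zero_mem _
  | add a b _ _ ha hb => rw [Matrix.mulVec_add]; exact Submodule.add_mem _ ha hb
  | mem i v hv =>
    obtain ⟨hvW, hv⟩ := hv
    obtain ⟨a, ha⟩ := mem_boseMesner_iff.1 (hQ.1.mem e)
    obtain ⟨l, hl⟩ : ∃ l : ℂ, ∀ y, S.dist x y = i → E e x y = l := by
      by_cases h : i < D + 1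
      · exact ⟨a ⟨i, h⟩, fun y hy => by rw [ha]; exact congrArg a (Fin.ext hy)⟩
      · exact ⟨0, fun y hy => absurd (S.dist_le x y) (by omega)⟩
    set B := Matrix.diagonal (fun y => E e x y) with hB
    have htri : ∀ j : Fin (D + 1), (j : ℕ) + 1 ≤ i → E j *ᵥ (B *ᵥ v) = 0 := by
      intro j hj
      have h1 : v = ∑ h, E h *ᵥ v := by
        rw [← Matrix.sum_mulVec, hQ.1.sum_eq_one, Matrix.one_mulVec]
      rw [h1, Matrix.mulVec_sum, Matrix.mulVec_sum]
      refine Finset.sum_eq_zero fun h _ => ?_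
      by_cases hh : (h : ℕ) ≤ i
      · rw [hv.2 h hh, Matrix.mulVec_zero, Matrix.mulVec_zero]
      · rw [Matrix.mulVec_mulVec, Matrix.mulVec_mulVec,
          hQ.mul_diagonal_mul_eq_zero (i := e) (j := h) (h := j) (Or.inr (Or.inr (by omega))),
          Matrix.zero_mulVec]
    have h1 : B *ᵥ v = (B *ᵥ v - l • v) + l • v := by abel
    rw [h1]
    refine Submodule.add_mem _ ?_ (Submodule.smul_mem _ _ (Submodule.mem_iSup_of_mem i ⟨hvW, hv⟩))
    -- There is no piece below index 0: a vector supported at `x` is simply scaled by `l`.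
    rcases i with _ | i
    · convert Submodule.zero_mem _
      ext y
      rw [Pi.sub_apply, hB, Matrix.mulVec_diagonal, Pi.smul_apply, Pi.zero_apply, smul_eq_mul]
      rcases Nat.eq_zero_or_pos (S.dist x y) with h | h
      · rw [hl y h, sub_self]
      · rw [hv.1 y h]; ring
    refine Submodule.mem_iSup_of_mem i
      ⟨W.sub_mem (hW v hvW) (W.smul_mem l hvW), mem_splitSpace.2 ⟨fun y hy => ?_, fun j hj => ?_⟩⟩
    · rw [Pi.sub_apply, hB, Matrix.mulVec_diagonal, Pi.smul_apply, smul_eq_mul]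
      rcases eq_or_lt_of_le (Nat.succ_le_of_lt hy) with h | h
      · rw [hl y h.symm, sub_self]
      · rw [hv.1 y h]; ring
    · rw [Matrix.mulVec_sub, Matrix.mulVec_smul, htri j (by omega), hv.2 j (by omega), smul_zero,
        sub_zero]

/-- The vectors orthogonal to the primary module `M x̂`. -/
def primaryOrthogonal (S : SymmAssocScheme X D) (x : X) : Submodule ℂ (X → ℂ) where
  carrier := {v | ∀ F ∈ S.boseMesner, (F *ᵥ v) x = 0}
  zero_mem' F _ := by rw [Matrix.mulVec_zero]; rfl
  add_mem' {a b} ha hb F hF := by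
    rw [Matrix.mulVec_add, Pi.add_apply, ha F hF, hb F hF, add_zero]
  smul_mem' c a ha F hF := by rw [Matrix.mulVec_smul, Pi.smul_apply, ha F hF, smul_zero]

omit [DecidableEq X] in
lemma mem_primaryOrthogonal_iff {x : X} {v : X → ℂ} :
    v ∈ S.primaryOrthogonal x ↔ ∀ i, (S.assocMatrix i *ᵥ v) x = 0 := by
  refine ⟨fun h i => h _ (assocMatrix_mem i), fun h F hF => ?_⟩
  obtain ⟨c, rfl⟩ := (Submodule.mem_span_range_iff_exists_fun ℂ).1 hF
  rw [Matrix.sum_mulVec, Finset.sum_apply]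
  refine Finset.sum_eq_zero fun i _ => ?_
  rw [Matrix.smul_mulVec, Pi.smul_apply, h i, smul_zero]

/-- Membership only tests the sums over spheres about `x`, each of which a dual idempotent keeps or
annuls. For the `A_i`, closure of the Bose-Mesner algebra under products suffices. -/
lemma terwilliger_mulVec_mem_primaryOrthogonal {x : X} {F : Matrix X X ℂ}
    (hF : F ∈ S.terwilliger x) : ∀ v ∈ S.primaryOrthogonal x, F *ᵥ v ∈ S.primaryOrthogonal x := by
  refine terwilliger_mulVec_mem (fun i v hv => ?_) (fun i v hv => ?_) hF
  · intro G hG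
    rw [Matrix.mulVec_mulVec]
    exact hv _ (mul_mem_boseMesner hG (assocMatrix_mem i))
  · rw [mem_primaryOrthogonal_iff] at *
    intro j
    rw [assocMatrix_mulVec_apply]
    simp only [dualIdem_mulVec_apply]
    by_cases h : j = i
    · rw [← hv j, assocMatrix_mulVec_apply]
      refine Finset.sum_congr rfl fun y hy => ?_
      rw [Finset.mem_filter] at hy
      rw [if_pos (hy.2.trans h)]
    · refine Finset.sum_eq_zero fun y hy => ?_
      rw [Finset.mem_filter] at hy
      rw [if_neg (fun h' => h (hy.2.symm.trans h'))]

/-- Suppose that `r^*(W) ≤ r(W)` for each irreducible module `W` with `1 ≤ r(W) ≤ i`. Then a vector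
supported on the sphere of radius `i` around `x`, orthogonal to the primary module and to
the first `i + 1` eigenspaces, vanishes. -/
theorem eq_zero_of_dualEndpoint_le (hD : 1 ≤ D) (hP : S.IsMetric) (hQ : S.IsCometric E) {x : X}
    (i : Fin (D + 1))
    (hmod : ∀ W : Submodule ℂ (X → ℂ), S.IsIrreducibleModule x W →
      1 ≤ S.endpoint x W → S.endpoint x W ≤ i → dualEndpoint E W ≤ S.endpoint x W)
    {u : X → ℂ} (hsupp : ∀ y, S.cls x y ≠ i → u y = 0) (hu : u ∈ S.primaryOrthogonal x)
    (hEu : ∀ j : Fin (D + 1), j ≤ i → E j *ᵥ u = 0) : u = 0 := by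
  by_contra hu0
  obtain ⟨W, hW, hWmin, w, hwW, hw0, hw⟩ := exists_irreducible (S := S) (x := x) hu0
  have hWP : W ≤ S.primaryOrthogonal x :=
    hWmin _ (fun F hF => terwilliger_mulVec_mem_primaryOrthogonal hF) hu
  have hsuppw : ∀ y, S.cls x y ≠ i → w y = 0 := by
    intro y hy
    have h1 := hw _ (dualIdem_mem (S.cls x y)) (by
      ext z
      rw [dualIdem_mulVec_apply]
      split_ifs with h
      · exact hsupp z (h ▸ hy)
      · rfl)
    have h2 := congrFun h1 y
    rwa [dualIdem_mulVec_apply, if_pos rfl] at h2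
  have hiw : S.dualIdem x i *ᵥ w ≠ 0 := by
    intro h
    apply hw0
    ext y
    by_cases hy : S.cls x y = i
    · have h2 := congrFun h y
      rwa [dualIdem_mulVec_apply, if_pos hy] at h2
    · exact hsuppw y hy
  have hr : S.endpoint x W ≤ i := leastIndex_le hwW hiw
  -- Endpoint 0 would give a vector of `W` with nonzero entry at `x`, against orthogonality to `x̂`.
  have hr1 : 1 ≤ S.endpoint x W := by
    rw [Nat.one_le_iff_ne_zero]
    intro h
    obtain ⟨j, hj, v, hvW, hv⟩ := exists_leastIndex_eq hwW hiw
    apply hv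
    ext y
    rw [dualIdem_mulVec_apply]
    split_ifs with h1
    · have h0 : S.cls x y = 0 := h1.trans (Fin.ext (hj.trans h))
      rw [S.cls_eq_zero_iff] at h0
      have h2 := hWP hvW 1 one_mem_boseMesner
      rwa [Matrix.one_mulVec, h0] at h2
    · rfl
  have hrr := hmod W hW hr1 hr
  obtain ⟨k, hk⟩ : ∃ k, E k *ᵥ w ≠ 0 := by
    by_contra! h
    apply hw0
    rw [← Matrix.one_mulVec w, ← hQ.1.sum_eq_one, Matrix.sum_mulVec]
    exact Finset.sum_eq_zero fun k _ => h k
  obtain ⟨s, hs, v, hvW, hv⟩ := exists_leastIndex_eq hwW hk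
  set U := ⨆ i, W ⊓ S.splitSpace E x i with hU
  have hUW : U ≤ W := iSup_le fun i => inf_le_left
  have hUs : ∀ z ∈ U, E s *ᵥ z = 0 := by
    intro z hz
    induction hz using Submodule.iSup_induction' with
    | zero => rw [Matrix.mulVec_zero]
    | add a b _ _ ha hb => rw [Matrix.mulVec_add, ha, hb, add_zero]
    | mem n z hz =>
      by_cases hn : (s : ℕ) ≤ n
      · exact hz.2.2 s hn
      · have hz0 : z = 0 := by
          ext y
          by_contra hzy
          have h1 := leastIndex_le (F := S.dualIdem x) (i := S.cls x y) hz.1 (fun h => hzy (by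
            have h2 := congrFun h y
            rwa [dualIdem_mulVec_apply, if_pos rfl] at h2))
          have h2 : ¬ n < S.dist x y := fun h => hzy (hz.2.1 y h)
          have h3 : leastIndex E W ≤ leastIndex (S.dualIdem x) W := hrr
          rw [dist] at h2
          omega
        rw [hz0, Matrix.mulVec_zero]
  let e : Fin (D + 1) := ⟨1, by omega⟩
  have hUT : ∀ F ∈ S.terwilliger x, ∀ u ∈ U, F *ᵥ u ∈ U := by
    intro F hF
    refine terwilliger_mulVec_mem (fun j => hP.assocMatrix_mulVec_mem (e := e) rfl
      (assocMatrix_one_mulVec_mem hP hQ.1 rfl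
        (hW.2.1 _ (mem_terwilliger_of_mem (assocMatrix_mem _)))) j) (fun j => ?_) hF
    exact hQ.diagonal_mulVec_mem (e := e) rfl (diagonal_one_mulVec_mem hQ rfl
      (hW.2.1 _ (diagonal_mem_terwilliger (hQ.1.mem _)))) (assocMatrix_mem j)
  have hwU : w ∈ U := by
    refine Submodule.mem_iSup_of_mem (i : ℕ) ⟨hwW, fun y hy => hsuppw y fun h => ?_, fun j hj => ?_⟩
    · rw [dist, h] at hy
      exact lt_irrefl _ hy
    · exact hw _ (mem_terwilliger_of_mem (hQ.1.mem j)) (hEu j hj)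
  rcases hW.2.2 U hUW hUT with h | h
  · rw [h, Submodule.mem_bot] at hwU
    exact hw0 hwU
  · exact hv (hUs v (h ▸ hvW))

end TerwilligerModules

/-! ### Relative designs and antipodal schemes -/

section Designs

variable {X : Type*} [Fintype X] [DecidableEq X] {D : ℕ} {S : SymmAssocScheme X D}
  {E : Fin (D + 1) → Matrix X X ℂ}

/-- If the restriction of `χ` to the sphere of radius `i ≤ t` around `x` is a relative `t`-design
with respect to `x`, and `r^*(W) ≤ r(W)` for the irreducible modules with `1 ≤ r(W) ≤ i`, then `χ`
is constant on that sphere. -/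
theorem apply_eq_apply_of_isRelativeDesign (hD : 1 ≤ D) (hP : S.IsMetric) (hQ : S.IsCometric E)
    {x : X} (i : Fin (D + 1)) {t : ℕ} (hit : (i : ℕ) ≤ t) {χ : X → ℂ}
    (hχ : IsRelativeDesign E t x (S.dualIdem x i *ᵥ χ))
    (hmod : ∀ W : Submodule ℂ (X → ℂ), S.IsIrreducibleModule x W →
      1 ≤ S.endpoint x W → S.endpoint x W ≤ i → dualEndpoint E W ≤ S.endpoint x W)
    {y z : X} (hy : S.cls x y = i) (hz : S.cls x z = i) : χ y = χ z := by
  -- The mean of `χ` on the sphere, which makes `u` orthogonal to the primary module.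
  set c : ℂ := (∑ y with S.cls x y = i, χ y) / (Finset.univ.filter fun y => S.cls x y = i).card
    with hc
  set u : X → ℂ := S.dualIdem x i *ᵥ χ - c • S.assocMatrix i *ᵥ Pi.single x 1 with hu
  have hui : ∀ v, S.cls x v = i → u v = χ v - c := by
    intro v hv
    simp [hu, dualIdem_mulVec_apply, hv, assocMatrix, S.cls_symm v x]
  have hui' : ∀ v, S.cls x v ≠ i → u v = 0 := by
    intro v hv
    simp [hu, dualIdem_mulVec_apply, hv, assocMatrix, S.cls_symm v x]
  have hup : u ∈ S.primaryOrthogonal x := by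
    rw [mem_primaryOrthogonal_iff]
    intro j
    rw [assocMatrix_mulVec_apply]
    by_cases hj : j = i
    · subst hj
      have hcard : ((Finset.univ.filter fun y => S.cls x y = j).card : ℂ) ≠ 0 := by
        rw [Nat.cast_ne_zero, ← Nat.pos_iff_ne_zero, Finset.card_pos]
        exact ⟨y, by simp [hy]⟩
      rw [Finset.sum_congr rfl fun v hv => hui v (Finset.mem_filter.1 hv).2,
        Finset.sum_sub_distrib, Finset.sum_const, nsmul_eq_mul, hc, mul_div_cancel₀ _ hcard,
        sub_self]
    · exact Finset.sum_eq_zero fun v hv => hui' v (by rwa [(Finset.mem_filter.1 hv).2])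
  have hu0 : u = 0 := by
    refine eq_zero_of_dualEndpoint_le hD hP hQ i hmod hui' hup fun j hj => ?_
    have hEx := hup _ (hQ.1.mem j)
    by_cases hj0 : j = 0
    · subst hj0
      ext v
      rw [Pi.zero_apply, ← hEx]
      simp [Matrix.mulVec, dotProduct, hQ.1.zero_eq]
    have hEjx : E j *ᵥ Pi.single x 1 ≠ 0 := by
      intro h
      apply hQ.1.apply_self_ne_zero j x
      simpa using congrFun h x
    have hdep := hχ j (Nat.one_le_iff_ne_zero.2 fun h => hj0 (Fin.ext h)) (le_trans hj hit)
    rw [LinearIndependent.pair_symm_iff, LinearIndependent.pair_iff' hEjx] at hdep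
    push Not at hdep
    obtain ⟨a, ha⟩ := hdep
    obtain ⟨θ, -, hθ⟩ := hQ.1.exists_eigenvalues (assocMatrix_mem (S := S) i)
    -- `E_j u` is a multiple of `E_j x̂` whose entry at `x` vanishes; since `E_j x x ≠ 0`, the
    -- multiple is zero.
    have h1 : E j *ᵥ u = (a - c * θ j) • E j *ᵥ Pi.single x 1 := by
      rw [hu, Matrix.mulVec_sub, ← ha, Matrix.mulVec_smul, Matrix.mulVec_mulVec, (hθ j).2,
        Matrix.smul_mulVec, sub_smul, smul_smul]
    rw [h1] at hEx ⊢
    have h2 : (a - c * θ j) * E j x x = 0 := by simpa using hEx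
    rw [(mul_eq_zero.1 h2).resolve_right (hQ.1.apply_self_ne_zero j x), zero_smul]
  have h1 := hui y hy
  have h2 := hui z hz
  rw [hu0, Pi.zero_apply] at h1 h2
  exact (sub_eq_zero.1 h1.symm).trans (sub_eq_zero.1 h2.symm).symm

omit [DecidableEq X] in
lemma IsMetric.dist_eq_sub_one (hP : S.IsMetric) (hD : 2 ≤ D)
    (hanti : ∀ x y z, S.dist x y = D → S.dist y z = D → x = z ∨ S.dist x z = D)
    {x y z : X} (hxy : S.dist x y = 1) (hyz : S.dist y z = D) : S.dist x z = D - 1 := by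
  have h1 := hP.dist_triangle y x z
  have h2 := S.dist_le x z
  have h3 := S.dist_comm x y
  have h4 : S.dist x z ≠ D := by
    intro h
    rcases hanti x z y h (by rw [S.dist_comm, hyz]) with h | h
    · subst h; simp [S.dist_self] at hxy
    · omega
  omega

lemma one_add_assocMatrix_last_mul_apply (F : Matrix X X ℂ) (x z : X) :
    ((1 + S.assocMatrix (Fin.last D)) * F) x z =
      F x z + ∑ y with S.cls x y = Fin.last D, F y z := by
  rw [Matrix.add_mul, Matrix.one_mul, Matrix.add_apply, Matrix.mul_apply, Finset.sum_filter]
  simp [assocMatrix]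

/-- In an antipodal scheme, a primitive idempotent either annihilates the characteristic vectors of
the antipodal classes or is constant on them. -/
lemma IsPrimitiveIdempotents.antipodal_dichotomy (hE : S.IsPrimitiveIdempotents E) (hD : 1 ≤ D)
    (hanti : ∀ x y z, S.dist x y = D → S.dist y z = D → x = z ∨ S.dist x z = D)
    (j : Fin (D + 1)) :
    ((1 + S.assocMatrix (Fin.last D)) * E j = 0 ∧ E j * (1 + S.assocMatrix (Fin.last D)) = 0) ∨
      ∀ x y z, S.dist x y = D → E j x z = E j y z := by
  obtain ⟨θ, -, hθ⟩ := hE.exists_eigenvalues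
    (S.boseMesner.add_mem one_mem_boseMesner (assocMatrix_mem (S := S) (Fin.last D)))
  rw [(hθ j).1, (hθ j).2]
  by_cases h0 : θ j = 0
  · simp [h0]
  refine Or.inr fun x y z hxy => mul_left_cancel₀ h0 ?_
  have hfib : ∀ p q, S.dist p q = D →
      insert p (Finset.univ.filter fun v => S.cls p v = Fin.last D) ⊆
        insert q (Finset.univ.filter fun v => S.cls q v = Fin.last D) := by
    intro p q hpq v
    simp only [Finset.mem_insert, Finset.mem_filter, Finset.mem_univ, true_and, cls_eq_iff,
      Fin.val_last]
    rintro (rfl | hv)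
    · exact Or.inr (by rw [S.dist_comm, hpq])
    · exact (hanti q p v (by rw [S.dist_comm, hpq]) hv).imp_left Eq.symm
  have hval : ∀ p, θ j * E j p z =
      ∑ v ∈ insert p (Finset.univ.filter fun v => S.cls p v = Fin.last D), E j v z := by
    intro p
    rw [Finset.sum_insert (by
      simp only [Finset.mem_filter, Finset.mem_univ, true_and, cls_eq_iff, S.dist_self,
        Fin.val_last]
      omega), ← one_add_assocMatrix_last_mul_apply, (hθ j).1]
    rfl
  rw [hval, hval, (hfib x y hxy).antisymm (hfib y x (by rw [S.dist_comm, hxy]))]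

/-- An antipodal `P`- and `Q`-polynomial scheme with `D ≥ 3`, such that `r^*(W) ≤ r(W)` for the
irreducible modules of endpoint one with respect to some vertex, is a double cover. -/
theorem antipode_unique (hD : 3 ≤ D) (hP : S.IsMetric) (hQ : S.IsCometric E)
    (hanti : ∀ x y z, S.dist x y = D → S.dist y z = D → x = z ∨ S.dist x z = D) {x : X}
    (hmod : ∀ W : Submodule ℂ (X → ℂ), S.IsIrreducibleModule x W →
      1 ≤ S.endpoint x W → S.endpoint x W ≤ 1 → dualEndpoint E W ≤ S.endpoint x W) :
    (Finset.univ.filter fun y => S.cls x y = Fin.last D).card = 1 := by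
  have hE := hQ.1
  let e : Fin (D + 1) := ⟨1, by omega⟩
  let e₂ : Fin (D + 1) := ⟨2, by omega⟩
  have hsep : ∀ u v w, E e u v = E e u w → S.dist u v = S.dist u w :=
    fun u v w h => hQ.dist_eq_of_apply_eq rfl h
  have hsymm := fun j => apply_comm_of_mem (hE.mem j)
  obtain ⟨y, hy⟩ := hP.exists_dist_eq x le_rfl
  -- Otherwise `E_1` would not separate `x` from its antipode `y`.
  have h1 : (1 + S.assocMatrix (Fin.last D)) * E e = 0 ∧
      E e * (1 + S.assocMatrix (Fin.last D)) = 0 := by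
    refine (hE.antipodal_dichotomy (by omega) hanti e).resolve_right fun h => ?_
    have h2 := h x y x hy
    rw [hsymm e y x] at h2
    have h3 := hsep _ _ _ h2
    rw [S.dist_self, hy] at h3
    omega
  rcases hE.antipodal_dichotomy (by omega) hanti e₂ with h2 | h2
  · exfalso
    obtain ⟨y₁, hy₁⟩ := hP.exists_dist_eq x (i := 1) (by omega)
    obtain ⟨y₂, hy₂, hy₂₁⟩ := hP.exists_dist (x := x) (y := y₁) (i := 1) (j := 2) (by omega)
      (by omega) (Or.inr (Or.inr (by omega)))
    have hne : y₁ ≠ y₂ := by rintro rfl; simp [S.dist_self] at hy₂₁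
    -- If `1 + A_D` annihilates `E_2` too, then `E_1 w = 0` will follow, contradicting
    -- `eq_zero_of_dualEndpoint_le` at radius one.
    set w : X → ℂ := Pi.single y₁ 1 - Pi.single y₂ 1 with hw
    have hw0 : ∀ v, S.dist x v ≠ 1 → w v = 0 := by
      intro v hv
      have hv₁ : v ≠ y₁ := by rintro rfl; exact hv hy₁
      have hv₂ : v ≠ y₂ := by rintro rfl; exact hv hy₂
      simp [hw, hv₁, hv₂]
    have hFw : ∀ (F : Matrix X X ℂ) (v : X), (F *ᵥ w) v = F v y₁ - F v y₂ := by
      intro F v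
      simp [hw, Matrix.mulVec_sub]
    have hE0w : E 0 *ᵥ w = 0 := by
      ext v
      simp [hFw, hE.zero_eq]
    set A := S.assocMatrix (Fin.last D) with hA
    set f := (1 + A) *ᵥ w with hf
    have hEf : ∀ j : Fin (D + 1), (j : ℕ) ≤ 2 → E j *ᵥ f = 0 := by
      intro j hj
      rw [hf, Matrix.mulVec_mulVec]
      obtain h | h | h : (j : ℕ) = 0 ∨ (j : ℕ) = 1 ∨ (j : ℕ) = 2 := by omega
      · obtain ⟨θ, -, hθ⟩ := hE.exists_eigenvalues
          (S.boseMesner.add_mem one_mem_boseMesner (assocMatrix_mem (S := S) (Fin.last D)))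
        rw [(hθ j).2, Matrix.smul_mulVec, show j = 0 from Fin.ext h, hE0w, smul_zero]
      · rw [show j = e from Fin.ext h, h1.2, Matrix.zero_mulVec]
      · rw [show j = e₂ from Fin.ext h, h2.2, Matrix.zero_mulVec]
    obtain ⟨q, hq⟩ := hP.exists_dist_eq x (i := D - 1) (by omega)
    set B := Matrix.diagonal (fun v => E e x v) with hB
    -- `w` and `A w` are supported at distances 1 and `D - 1` from `x`, so `B` acts on each as a
    -- scalar. These scalars differ because `D ≥ 3`.
    have hBf : B *ᵥ f = (E e x y₁ - E e x q) • w + E e x q • f := by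
      have hf' : f = w + A *ᵥ w := by rw [hf, Matrix.add_mulVec, Matrix.one_mulVec]
      have hBw : ∀ v, E e x v * w v = E e x y₁ * w v := by
        intro v
        by_cases hv : S.dist x v = 1
        · rw [apply_congr_of_mem (hE.mem e) (hv.trans hy₁.symm)]
        · rw [hw0 v hv, mul_zero, mul_zero]
      have hBAw : ∀ v, E e x v * (A *ᵥ w) v = E e x q * (A *ᵥ w) v := by
        intro v
        by_cases hv : S.dist x v = D - 1
        · rw [apply_congr_of_mem (hE.mem e) (hv.trans hq.symm)]
        · have hz : ∀ y, S.dist x y = 1 → A v y = 0 := by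
            intro y hy
            rw [hA, assocMatrix, Matrix.of_apply, if_neg]
            rw [cls_eq_iff, S.dist_comm]
            exact fun h => hv (hP.dist_eq_sub_one (by omega) hanti hy h)
          rw [hFw, hz _ hy₁, hz _ hy₂, sub_self, mul_zero, mul_zero]
      ext v
      rw [hB, Matrix.mulVec_diagonal, hf']
      simp only [Pi.add_apply, Pi.smul_apply, smul_eq_mul]
      linear_combination hBw v + hBAw v
    -- `f` has only components `E_h` with `h ≥ 3`, and `E_1 B E_h = 0` for these.
    have hEBf : E e *ᵥ (B *ᵥ f) = 0 := by
      have h3 : f = ∑ h, E h *ᵥ f := by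
        rw [← Matrix.sum_mulVec, hE.sum_eq_one, Matrix.one_mulVec]
      rw [h3, Matrix.mulVec_sum, Matrix.mulVec_sum]
      refine Finset.sum_eq_zero fun h _ => ?_
      by_cases hh : (h : ℕ) ≤ 2
      · rw [hEf h hh, Matrix.mulVec_zero, Matrix.mulVec_zero]
      · rw [Matrix.mulVec_mulVec, Matrix.mulVec_mulVec,
          hQ.mul_diagonal_mul_eq_zero (i := e) (j := h) (h := e)
            (Or.inr (Or.inr (by simp only [e]; omega))), Matrix.zero_mulVec]
    have hE1w : E e *ᵥ w = 0 := by
      rw [hBf, Matrix.mulVec_add, Matrix.mulVec_smul, Matrix.mulVec_smul,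
        hEf e (by simp [e]), smul_zero, add_zero] at hEBf
      refine (smul_eq_zero.1 hEBf).resolve_left fun h => ?_
      have h3 := hsep _ _ _ (sub_eq_zero.1 h)
      omega
    have hwz : w = 0 := by
      refine eq_zero_of_dualEndpoint_le (by omega) hP hQ e hmod
        (fun v hv => hw0 v fun h => hv (S.cls_eq_iff.2 h)) ?_ ?_
      · intro F hF
        rw [hFw, apply_congr_of_mem hF (hy₁.trans hy₂.symm), sub_self]
      · intro j hj
        rcases Nat.le_one_iff_eq_zero_or_eq_one.1 (show (j : ℕ) ≤ 1 from hj) with h | h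
        · rw [show j = 0 from Fin.ext h, hE0w]
        · rw [show j = e from Fin.ext h, hE1w]
    have h3 := congrFun hwz y₁
    simp [hw, hne] at h3
  · obtain ⟨z, hz⟩ := hP.exists_dist_eq x (i := 1) (by omega)
    obtain ⟨-, q, hq, hq'⟩ := hQ
    set k : ℂ := ((Finset.univ.filter fun y => S.cls x y = Fin.last D).card : ℂ) with hk
    have hyz : S.dist y z = D - 1 := by
      rw [S.dist_comm]
      exact hP.dist_eq_sub_one (by omega) hanti (by rw [S.dist_comm, hz]) hy
    -- Writing `s_i` for the entry of `E_1` at distance `i`, this says `s_0 + k s_D = 0` and `s_1 +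
    -- k s_{D-1} = 0`.
    have hsum : ∀ u, S.dist x u = 0 ∨ S.dist x u = 1 → E e x u + k * E e y u = 0 := by
      intro u hu
      have h3 := congrFun (congrFun h1.1 x) u
      rw [one_add_assocMatrix_last_mul_apply, Matrix.zero_apply] at h3
      rw [← h3, hk, ← nsmul_eq_mul, ← Finset.sum_const]
      congr 1
      refine Finset.sum_congr rfl fun v hv => ?_
      rw [Finset.mem_filter, cls_eq_iff, Fin.val_last] at hv
      refine apply_congr_of_mem (hE.mem e) ?_
      rcases hu with hu | hu
      · rw [← S.dist_eq_zero.1 hu, S.dist_comm, hy, S.dist_comm, hv.2]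
      · rw [S.dist_comm, S.dist_comm v,
          hP.dist_eq_sub_one (by omega) hanti (by rw [S.dist_comm, hu]) hy,
          hP.dist_eq_sub_one (by omega) hanti (by rw [S.dist_comm, hu]) hv.2]
    -- `E_1 ∘ E_1` is a combination of `E_0, E_1, E_2`, and `E_0, E_2` agree at the antipodes `x,
    -- y`. Subtracting the two rows and cancelling gives `s_0 + s_D = c = s_1 + s_{D-1}`; with
    -- `hsum`, `k ≠ 1` would force `s_D = s_{D-1}`.
    obtain ⟨c, hc⟩ : ∃ c : ℂ, ∀ u, E e x u ≠ E e y u → E e x u + E e y u = c := by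
      refine ⟨(Fintype.card X : ℂ)⁻¹ * q e e e, fun u hu => ?_⟩
      have hquad : ∀ v, E e v u * E e v u = (Fintype.card X : ℂ)⁻¹ *
          (q e e 0 * E 0 v u + q e e e * E e v u + q e e e₂ * E e₂ v u) := by
        intro v
        have h3 := congrFun (congrFun (hq e e) v) u
        rw [Matrix.hadamard_apply, Matrix.smul_apply, Matrix.sum_apply, smul_eq_mul] at h3
        rw [h3, ← Finset.sum_subset (Finset.subset_univ {0, e, e₂}), Finset.sum_insert,
          Finset.sum_insert, Finset.sum_singleton]
        · simp only [Matrix.smul_apply, smul_eq_mul]; ring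
        · simp [e, e₂]
        · simp [e, e₂, Fin.ext_iff]
        · intro h _ hh
          rw [Matrix.smul_apply, (hq' e e h).1, zero_smul]
          refine Or.inl ?_
          simp only [Finset.mem_insert, Finset.mem_singleton, Fin.ext_iff, Fin.val_zero, e,
            e₂] at hh ⊢
          omega
      have h0 : E 0 x u = E 0 y u := by simp [hE.zero_eq]
      have h3 := hquad x
      have h4 := hquad y
      rw [← h0, ← h2 x y u hy] at h4
      refine mul_left_cancel₀ (sub_ne_zero.2 hu) ?_
      linear_combination h3 - h4
    have hx0 := hc x fun h => by
      rw [hsymm e y x] at h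
      have h3 := hsep _ _ _ h
      rw [S.dist_self, hy] at h3
      omega
    have hz0 := hc z fun h => by
      rw [hsymm e x z, hsymm e y z] at h
      have h3 := hsep _ _ _ h
      rw [S.dist_comm, hz, S.dist_comm, hyz] at h3
      omega
    have hsx := hsum x (Or.inl (S.dist_self x))
    have hsz := hsum z (Or.inr hz)
    by_contra hk1
    have hk1' : (1 - k : ℂ) ≠ 0 := fun h => hk1 (by
      have : k = 1 := (sub_eq_zero.1 h).symm
      rw [hk] at this
      exact_mod_cast this)
    have h3 : E e y x = E e y z := by
      refine mul_left_cancel₀ hk1' ?_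
      linear_combination hx0 - hsx - hz0 + hsz
    have h4 := hsep _ _ _ h3
    rw [S.dist_comm, hy, hyz] at h4
    omega

lemma star_charVec_dotProduct_ne_zero_iff (Y : Finset X) (i : Fin (D + 1)) :
    star (charVec Y) ⬝ᵥ (S.assocMatrix i *ᵥ charVec Y) ≠ 0 ↔
      ∃ x ∈ Y, ∃ y ∈ Y, S.cls x y = i := by
  have h : star (charVec Y) ⬝ᵥ (S.assocMatrix i *ᵥ charVec Y) =
      ((∑ x ∈ Y, ∑ y ∈ Y, if S.cls x y = i then 1 else 0 : ℕ) : ℂ) := by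
    simp [dotProduct, assocMatrix_mulVec_apply, charVec, apply_ite, Finset.inter_comm _ Y,
      Finset.inter_filter]
  rw [h, Nat.cast_ne_zero]
  simp [Finset.sum_eq_zero_iff]

lemma minDistance_spec {Y : Finset X} (hY : 1 < Y.card) :
    (∃ i : Fin (D + 1), (i : ℕ) = S.minDistance Y ∧ i ≠ 0 ∧ ∃ x ∈ Y, ∃ y ∈ Y, S.cls x y = i) ∧
      ∀ x ∈ Y, ∀ y ∈ Y, x ≠ y → S.minDistance Y ≤ S.dist x y := by
  have hmem : ∀ x ∈ Y, ∀ y ∈ Y, x ≠ y → S.dist x y ∈ {n : ℕ | ∃ i : Fin (D + 1), (i : ℕ) = n ∧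
      i ≠ 0 ∧ star (charVec Y) ⬝ᵥ (S.assocMatrix i *ᵥ charVec Y) ≠ 0} := fun x hx y hy hxy =>
    ⟨S.cls x y, rfl, fun h => hxy ((S.cls_eq_zero_iff x y).1 h),
      (star_charVec_dotProduct_ne_zero_iff Y _).2 ⟨x, hx, y, hy, rfl⟩⟩
  refine ⟨?_, fun x hx y hy hxy => Nat.sInf_le (hmem x hx y hy hxy)⟩
  obtain ⟨x, hx, y, hy, hxy⟩ := Finset.one_lt_card.1 hY
  obtain ⟨i, hi, hi0, hne⟩ := Nat.sInf_mem ⟨_, hmem x hx y hy hxy⟩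
  exact ⟨i, hi, hi0, (star_charVec_dotProduct_ne_zero_iff Y i).1 hne⟩

end Designs

end SymmAssocScheme

/-! ### The main theorem, by cases on the minimum distance -/

theorem theorem9 {X : Type*} [Fintype X] [DecidableEq X] {D : ℕ} (hD : 3 ≤ D)
    (S : SymmAssocScheme X D) (hP : S.IsMetric)
    (E : Fin (D + 1) → Matrix X X ℂ) (hQ : S.IsCometric E)
    (hcyc : ¬ S.IsOrdinaryCycle)
    (Y : Finset X) (hY : SymmAssocScheme.IsCode Y)
    (t : ℕ) (ht : t ≤ D)
    (hdesign : ∀ x ∈ Y, ∀ k : Fin (D + 1), SymmAssocScheme.IsRelativeDesign E t x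
      (S.dualIdem x k *ᵥ SymmAssocScheme.charVec Y))
    (hmod : ∀ x ∈ Y, ∀ W : Submodule ℂ (X → ℂ), S.IsIrreducibleModule x W →
      1 ≤ S.endpoint x W → S.endpoint x W ≤ S.minDistance Y →
      SymmAssocScheme.dualEndpoint E W ≤ S.endpoint x W) :
    (S.graph.IsBipartite ∧ S.IsBipartiteHalf Y) ∨
    (S.IsAntipodalDoubleCover ∧ S.IsAntipodalPair Y) ∨
    t + 1 ≤ S.minDistance Y := by
  by_cases hδt : t + 1 ≤ S.minDistance Y
  · exact Or.inr (Or.inr hδt)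
  obtain ⟨⟨i, hi, hi0, x, hx, y, hy, hxy⟩, hsep⟩ := SymmAssocScheme.minDistance_spec (S := S) hY.1
  set δ := S.minDistance Y with hδ
  have hδ1 : 1 ≤ δ := by
    rw [← hi, Nat.one_le_iff_ne_zero]
    exact fun h => hi0 (Fin.ext h)
  have hiD := i.2
  have hG : ∀ u ∈ Y, (∃ v ∈ Y, S.dist u v = δ) → ∀ z, S.dist u z = δ → z ∈ Y := by
    rintro u hu ⟨v, hv, huv⟩ z huz
    rw [← hi, ← SymmAssocScheme.cls_eq_iff] at huv huz
    have h := SymmAssocScheme.apply_eq_apply_of_isRelativeDesign (by omega) hP hQ i (by omega)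
      (hdesign u hu i) (hi ▸ hmod u hu) huv huz
    by_contra hz
    simp [SymmAssocScheme.charVec, hv, hz] at h
  rw [SymmAssocScheme.cls_eq_iff, hi] at hxy
  have hsphere := hG x hx ⟨y, hy, hxy⟩
  obtain h1 | h2 | ⟨h3, hlt⟩ | hlast : δ = 1 ∨ δ = 2 ∨ (3 ≤ δ ∧ δ < D) ∨ δ = D := by omega
  · exfalso
    have hall : ∀ v, v ∈ Y ∧ ∃ u ∈ Y, S.dist v u = δ :=
      hP.forall_of_adj (by omega) (x := x) ⟨hx, y, hy, hxy⟩ fun v w hv hvw =>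
        ⟨hG v hv.1 hv.2 w (hvw.trans h1.symm), v, hv.1, by rw [S.dist_comm, hvw, h1]⟩
    have h4 := hY.2
    rw [Finset.eq_univ_iff_forall.2 fun v => (hall v).1, Finset.card_univ] at h4
    exact lt_irrefl _ h4
  · left
    rw [h2] at hG hsep hxy
    have hhalf := hP.isBipartiteHalf_of_closed hD hx hsep hG ⟨y, hy, hxy⟩
    exact ⟨SimpleGraph.IsBipartiteWith.isBipartite hhalf, hhalf⟩
  · exact absurd (hP.isOrdinaryCycle_of_separated h3 hlt x fun u v hu hv =>
      hsep u (hsphere u hu) v (hsphere v hv)) hcyc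
  · right; left
    rw [hlast] at hG hsep hxy hsphere
    have hsep' : ∀ u ∈ Y, ∀ v ∈ Y, u = v ∨ S.dist u v = D := fun u hu v hv =>
      or_iff_not_imp_left.2 fun h => (S.dist_le u v).antisymm (hsep u hu v hv h)
    have hanti : ∀ u v w, S.dist u v = D → S.dist v w = D → u = w ∨ S.dist u w = D := by
      intro u v w huv hvw
      -- Moving the triangle `v, u, w` to `x, y, z` puts `z` in `Y`, where distinct points are at
      -- distance `D`.
      obtain ⟨z, hxz, hzy⟩ := S.exists_transport (z := w) (huv.trans hxy.symm |> fun h =>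
        (S.dist_comm v u).trans h)
      have hz := hsphere z (hxz.trans hvw)
      rcases hsep' z hz y hy with h | h
      · left
        rw [h, S.dist_self] at hzy
        exact (S.dist_eq_zero.1 hzy.symm).symm
      · right
        rw [S.dist_comm, ← hzy, h]
    have hone := SymmAssocScheme.antipode_unique hD hP hQ hanti (x := x) fun W hW hr1 hr =>
      hmod x hx W hW hr1 (hr.trans hδ1)
    have hset : ∀ u, {v | S.cls u v = 0 ∨ S.cls u v = Fin.last D} = ((insert u
        (Finset.univ.filter fun v => S.cls u v = Fin.last D) : Finset X) : Set X) := by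
      intro u
      ext v
      simp [S.cls_eq_zero_iff, eq_comm]
    have hcard : ∀ u, (Finset.univ.filter fun v => S.cls u v = Fin.last D).card = 1 := by
      intro u
      have h := S.card_filter_eq_card_filter (x := u) (y := u) (x' := x) (y' := x)
        (by rw [S.dist_self, S.dist_self]) (Fin.last D) (Fin.last D)
      simpa only [S.cls_symm _ u, S.cls_symm _ x, and_self, hone] using h
    refine ⟨⟨⟨fun u => Or.inl ((S.cls_eq_zero_iff u u).2 rfl), fun {u v} h => ?_,
      fun {u v w} huv hvw => ?_⟩, fun u => ?_⟩, x, y, S.cls_eq_iff.2 hxy, ?_⟩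
    · rwa [S.cls_symm v u]
    · rw [S.cls_eq_zero_iff, SymmAssocScheme.cls_eq_iff] at *
      rcases huv with rfl | huv
      · exact hvw
      · rcases hvw with rfl | hvw
        · exact Or.inr huv
        · exact hanti u v w huv hvw
    · rw [hset, Set.ncard_coe_finset, Finset.card_insert_of_notMem, hcard]
      simp only [Finset.mem_filter, Finset.mem_univ, true_and, SymmAssocScheme.cls_eq_iff,
        S.dist_self, Fin.val_last]
      omega
    · ext v
      rw [Finset.mem_insert, Finset.mem_singleton]
      constructor
      · intro hv
        refine (hsep' x hx v hv).imp Eq.symm fun h => ?_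
        refine Finset.card_le_one.1 hone.le v ?_ y ?_ <;>
          simp [SymmAssocScheme.cls_eq_iff, h, hxy]
      · rintro (rfl | rfl)
        exacts [hx, hy]
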